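/- Let $F$ be a field. *Jordan normal form for $F$.* For a monic irreducible $f=x^d-a_1x^{d-1}-\cdots-a_d\in F[x]$ let $C_f$ be its $d\times d$ companion matrix (ones on the first subdiagonal, last column $a_d,\dots,a_1$), and let $E_d$ be the $d\times d$ matrix whose only nonzero entry is a $1$ in the top right corner. For $k\ge 1$ let $\mathcal J(f,k)$ be the $kd\times kd$ matrix with $k$ copies of $C_f$ on the block diagonal, copies of $E_d$ on the first block subdiagonal, and zeros elsewhere. A matrix $\operatorname{diag}(\mathcal J(f_1,k_1),\dots,\mathcal J(f_q,k_q))$ is said to be in Jordan normal form for $F$; its nonsingular part is the direct sum of the blocks with $f_i\ne x$. Let $J_k$ be the $k\times k$ matrix with ones on the first subdiagonal and zeros elsewhere. **Theorem 2.** Let $V,W$ be finite-dimensional linear spaces over a field $F$ and let $A:V\to W$, $B:W\to V$ be linear maps. The operator $AB$ has a matrix in Jordan normal form for $F$ in some basis of $W$, and, for each such Jordan form of $AB$, there exist bases of $V$ and $W$ with respect to which the pair $(A,B)$ has the representation $$\bigl(\operatorname{diag}(I,A_1,\dots,A_p,0),\ \operatorname{diag}(J_{AB},B_1,\dots,B_p,0)\bigr),\qquad(*)$$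 where $J_{AB}$ is the nonsingular part of the Jordan form of $AB$, $I$ is the identity matrix of the same size, the last blocks $0$ are zero matrices of sizes $r\times c$ and $c\times r$ with $r,c\ge 0$, and each $(A_i,B_i)$ is, for some $k=k_i\ge1$, one of $$\Bigl(\begin{pmatrix}I_k&0\end{pmatrix},\begin{pmatrix}0\\ I_k\end{pmatrix}\Bigr),\quad \Bigl(\begin{pmatrix}0\\ I_k\end{pmatrix},\begin{pmatrix}I_k&0\end{pmatrix}\Bigr),\quad (I_k,J_k),\quad (J_k,I_k),$$ the matrices $\begin{pmatrix}I_k&0\end{pmatrix}$ being $k\times(k+1)$ and $\begin{pmatrix}0\\ I_k\end{pmatrix}$ being $(k+1)\times k$. The representation $(*)$ is unique up to the order of the pairs of blocks $(A_i,B_i)$ and the order of the Jordan blocks within $J_{AB}$. Two pairs of matrices $(A,B)$ and $(C,D)$ with $A,C\in F^{m\times n}$ and $B,D\in F^{n\times m}$ are contragrediently equivalent, that is, $A=SCT^{-1}$ and $B=TDS^{-1}$ for some invertible $S\in F^{m\times m}$, $T\in F^{n\times n}$, if and only if $AB$ is similar to $CD$ and $$\operatorname{rank}A=\operatorname{rank}C,\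 \operatorname{rank}BA=\operatorname{rank}DC,\ \operatorname{rank}ABA=\operatorname{rank}CDC,\ \dots,\ \operatorname{rank}(BA)^t=\operatorname{rank}(DC)^t,$$ $$\operatorname{rank}B=\operatorname{rank}D,\ \operatorname{rank}AB=\operatorname{rank}CD,\ \operatorname{rank}BAB=\operatorname{rank}DCD,\ \dots,\ \operatorname{rank}(AB)^t=\operatorname{rank}(CD)^t,$$ where $t=\min\{m,n\}$ and the sequences run over all alternating products of $1,2,\dots,2t$ factors. -/

import Mathlib

open Polynomial Matrix
open scoped Kronecker

namespace Contragredient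

/-- The `m × n` matrix with ones on the main diagonal and zeros elsewhere. It is the identity `I_k`
for `m = n = k`, and the block matrix `(I_k 0)` for `m = k`, `n = k + 1`. -/
def diagMat (F : Type*) [Field F] (m n : ℕ) : Matrix (Fin m) (Fin n) F :=
  Matrix.of fun i j => if (i : ℕ) = (j : ℕ) then 1 else 0

/-- The `m × n` matrix with ones on the first subdiagonal and zeros elsewhere. It is the nilpotent
shift `J_k` for `m = n = k`, and the block matrix `(0 ; I_k)` (a zero row on top of `I_k`)
for `m = k + 1`, `n = k`. -/
def subdiagMat (F : Type*) [Field F] (m n : ℕ) : Matrix (Fin m) (Fin n) F :=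
  Matrix.of fun i j => if (i : ℕ) = (j : ℕ) + 1 then 1 else 0

section Jordan

/-- Data of one block of the Jordan normal form over `F`: a monic prime `poly ∈ F[x]` and the
number `mult ≥ 1` of copies of its companion matrix on the diagonal of the block. -/
structure JordanBlock (F : Type*) [Field F] where
  poly : F[X]
  monic : poly.Monic
  irreducible : Irreducible poly
  mult : ℕ
  mult_pos : 0 < mult

/-- The companion matrix of the monic polynomial `p = x^d - a_1 x^(d-1) - ⋯ - a_d`: ones on the
first subdiagonal, last column `a_d, …, a_1` (that is, minus the coefficients of `p`). -/
def companionMat {F : Type*} [Field F] (p : F[X]) :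
    Matrix (Fin p.natDegree) (Fin p.natDegree) F :=
  Matrix.of fun i j =>
    if (j : ℕ) + 1 = p.natDegree then -p.coeff i else if (i : ℕ) = (j : ℕ) + 1 then 1 else 0

/-- The `d × d` matrix whose only nonzero entry is a one in the top right corner. -/
def cornerMat (F : Type*) [Field F] (d : ℕ) : Matrix (Fin d) (Fin d) F :=
  Matrix.of fun i j => if (i : ℕ) = 0 ∧ (j : ℕ) + 1 = d then 1 else 0

variable {F : Type*} [Field F]

/-- The rows and columns of a block, as pairs (position of the `d × d` subblock, position in it). -/
abbrev JordanBlock.Idx (b : JordanBlock F) : Type := Fin b.mult × Fin b.poly.natDegree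

/-- The block itself: companion matrices along the diagonal, corner matrices right below them. -/
def JordanBlock.mat (b : JordanBlock F) : Matrix b.Idx b.Idx F :=
  (1 : Matrix (Fin b.mult) (Fin b.mult) F) ⊗ₖ companionMat b.poly +
    subdiagMat F b.mult b.mult ⊗ₖ cornerMat F b.poly.natDegree

/-- Rows and columns of the direct sum of a list of blocks. -/
abbrev JordanIdx (L : List (JordanBlock F)) : Type := (i : Fin L.length) × (L.get i).Idx

/-- The matrix in Jordan normal form for the field `F` with diagonal blocks `L`. -/
def jordanMat (L : List (JordanBlock F)) : Matrix (JordanIdx L) (JordanIdx L) F :=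
  Matrix.blockDiagonal' fun i => (L.get i).mat

/-- The matrix with diagonal blocks `L` is a Jordan normal form of the operator `T`. -/
def IsJordanForm {W : Type*} [AddCommGroup W] [Module F W]
    (L : List (JordanBlock F)) (T : W →ₗ[F] W) : Prop :=
  ∃ b : Module.Basis (JordanIdx L) F W, LinearMap.toMatrix b b T = jordanMat L

/-- A block is nonsingular exactly when its prime has no root at `0`, i.e. is not `x`. -/
def JordanBlock.Nonsingular (b : JordanBlock F) : Prop := b.poly ≠ X

open Classical in
/-- The nonsingular part of a Jordan matrix: the direct sum of its nonsingular blocks. -/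
noncomputable def nonsingularPart (L : List (JordanBlock F)) : List (JordanBlock F) :=
  L.filter fun b => decide b.Nonsingular

end Jordan

/-- The four types of pairs of blocks: `((I_k 0), (0 ; I_k))`, `((0 ; I_k), (I_k 0))`,
`(I_k, J_k)` and `(J_k, I_k)`. -/
inductive PairKind where
  | wide
  | tall
  | idShift
  | shiftId

/-- A pair of blocks `(A_i, B_i)`, given by its type and its parameter `k ≥ 1`. -/
structure PairBlock where
  kind : PairKind
  size : ℕ
  size_pos : 0 < size

/-- Number of rows of `A_i` (and of columns of `B_i`). -/
def PairBlock.rows : PairBlock → ℕ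
  | ⟨.wide, k, _⟩ => k
  | ⟨.tall, k, _⟩ => k + 1
  | ⟨.idShift, k, _⟩ => k
  | ⟨.shiftId, k, _⟩ => k

/-- Number of columns of `A_i` (and of rows of `B_i`). -/
def PairBlock.cols : PairBlock → ℕ
  | ⟨.wide, k, _⟩ => k + 1
  | ⟨.tall, k, _⟩ => k
  | ⟨.idShift, k, _⟩ => k
  | ⟨.shiftId, k, _⟩ => k

/-- The block `A_i`. -/
def PairBlock.matA (F : Type*) [Field F] : (b : PairBlock) → Matrix (Fin b.rows) (Fin b.cols) F
  | ⟨.wide, k, _⟩ => diagMat F k (k + 1)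
  | ⟨.tall, k, _⟩ => subdiagMat F (k + 1) k
  | ⟨.idShift, k, _⟩ => diagMat F k k
  | ⟨.shiftId, k, _⟩ => subdiagMat F k k

/-- The block `B_i`. -/
def PairBlock.matB (F : Type*) [Field F] : (b : PairBlock) → Matrix (Fin b.cols) (Fin b.rows) F
  | ⟨.wide, k, _⟩ => subdiagMat F (k + 1) k
  | ⟨.tall, k, _⟩ => diagMat F k (k + 1)
  | ⟨.idShift, k, _⟩ => subdiagMat F k k
  | ⟨.shiftId, k, _⟩ => diagMat F k k

section Canonical

variable {F : Type*} [Field F]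

/-- Rows of `diag(I, A_1, …, A_p, 0)`, where the block `0` has `r` rows. -/
abbrev RowIdx (L : List (JordanBlock F)) (P : List PairBlock) (r : ℕ) : Type :=
  JordanIdx L ⊕ (((i : Fin P.length) × Fin (P.get i).rows) ⊕ Fin r)

/-- Columns of `diag(I, A_1, …, A_p, 0)`, where the block `0` has `c` columns. -/
abbrev ColIdx (L : List (JordanBlock F)) (P : List PairBlock) (c : ℕ) : Type :=
  JordanIdx L ⊕ (((i : Fin P.length) × Fin (P.get i).cols) ⊕ Fin c)

/-- `diag(I, A_1, …, A_p, 0)`, with `I` of the size of the Jordan matrix of `L` and with an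
`r × c` block `0`. -/
def canonA (L : List (JordanBlock F)) (P : List PairBlock) (r c : ℕ) :
    Matrix (RowIdx L P r) (ColIdx L P c) F :=
  Matrix.fromBlocks 1 0 0
    (Matrix.fromBlocks (Matrix.blockDiagonal' fun i => (P.get i).matA F) 0 0 0)

/-- `diag(J, B_1, …, B_p, 0)`, with `J` the Jordan matrix of `L` and with a `c × r` block `0`. -/
def canonB (L : List (JordanBlock F)) (P : List PairBlock) (r c : ℕ) :
    Matrix (ColIdx L P c) (RowIdx L P r) F :=
  Matrix.fromBlocks (jordanMat L) 0 0
    (Matrix.fromBlocks (Matrix.blockDiagonal' fun i => (P.get i).matB F) 0 0 0)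

/-- In suitable bases of `V` and `W`, the pair `(A, B)` is
`(diag(I, A_1, …, A_p, 0), diag(J, B_1, …, B_p, 0))`. -/
def HasRepresentation {V W : Type*} [AddCommGroup V] [Module F V] [AddCommGroup W] [Module F W]
    (A : V →ₗ[F] W) (B : W →ₗ[F] V)
    (L : List (JordanBlock F)) (P : List PairBlock) (r c : ℕ) : Prop :=
  ∃ (bV : Module.Basis (ColIdx L P c) F V) (bW : Module.Basis (RowIdx L P r) F W),
    LinearMap.toMatrix bV bW A = canonA L P r c ∧ LinearMap.toMatrix bW bV B = canonB L P r c

end Canonical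

/-- `A = S C T⁻¹` and `B = T D S⁻¹` for some invertible `S`, `T`. -/
def ContragredientlyEquivalent {F : Type*} [Field F] {m n : ℕ}
    (A : Matrix (Fin m) (Fin n) F) (B : Matrix (Fin n) (Fin m) F)
    (C : Matrix (Fin m) (Fin n) F) (D : Matrix (Fin n) (Fin m) F) : Prop :=
  ∃ (S : Matrix (Fin m) (Fin m) F) (T : Matrix (Fin n) (Fin n) F),
    IsUnit S ∧ IsUnit T ∧ A = S * C * T⁻¹ ∧ B = T * D * S⁻¹

/-- Similarity of square matrices. -/
def Similar {F : Type*} [Field F] {m : ℕ} (X Y : Matrix (Fin m) (Fin m) F) : Prop :=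
  ∃ S : Matrix (Fin m) (Fin m) F, IsUnit S ∧ X = S * Y * S⁻¹

/-- Equality of the ranks of `A, BA, ABA, BABA, …, (BA)^t` with those of
`C, DC, CDC, DCDC, …, (DC)^t` (alternating products of `1, 2, …, 2t` factors). -/
def SameAlternatingRanks {F : Type*} [Field F] {m n : ℕ}
    (A : Matrix (Fin m) (Fin n) F) (B : Matrix (Fin n) (Fin m) F)
    (C : Matrix (Fin m) (Fin n) F) (D : Matrix (Fin n) (Fin m) F) (t : ℕ) : Prop :=
  (∀ k < t, (A * (B * A) ^ k).rank = (C * (D * C) ^ k).rank) ∧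
    ∀ k, 1 ≤ k → k ≤ t → ((B * A) ^ k).rank = ((D * C) ^ k).rank

end Contragredient

/-!
The pair `(A, B)` splits by the Fitting decompositions of `BA` and `AB` into a pair of invertible
maps and a pair whose products are nilpotent (`exists_hasRepresentation`).

In the invertible pair, a basis of the `W`-side that puts `AB` into Jordan normal form is pulled
back along `A`; then `A` becomes the identity matrix and `B` the Jordan matrix
(`exists_represents_of_bijective`). The Jordan normal form over an arbitrary field comes from the
structure theorem for the `F[x]`-module `W`: in `F[x] / (f ^ k)` the basis `f ^ a * x ^ i` turns
multiplication by `x` into a Jordan block (`exists_isJordanForm`).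

In the nilpotent pair one takes a longest chain `u ↦ A u ↦ B A u ↦ ⋯` (or one that starts in `W`)
and a functional that is `1` on its last vector. The compositions of this functional with the
alternating products of `A` and `B` have a triangular Gram matrix with the vectors of the chain,
so their common kernels are an invariant complement of the chain (`isCompl_of_hankel`,
`exists_splits`). By induction the pair is a direct sum of chains (`exists_represents_nil`). A
chain of length one is a zero row or column, and the longer ones are the four types of pairs of
blocks, according to the spaces in which they start and end.

Uniqueness is a matter of ranks. The ranks of the alternating products `A`, `BA`, `ABA`, … and
`B`, `AB`, `BAB`, … count the chains of each length and type (`perm_of_word_ranks`), and the ranks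
of `f(AB) ^ j`, for a prime `f ≠ x`, count the Jordan blocks of `f` (`perm_of_polyRank`), because
`f` acts on its own Jordan blocks as a shift and invertibly everywhere else. The same count shows
that the nonsingular blocks of every Jordan form of `AB` agree, up to order, with those of the
canonical form. For the criterion one gives both pairs the same nonsingular part; alternating
products of more than `2 min(m, n)` factors vanish on the nilpotent part, so the listed ranks
determine the other blocks (`perm_of_bounded_word_ranks`).
-/

namespace Contragredient

/-! ### Ranks of block diagonal matrices and of shift matrices -/

section Rank

variable {F : Type*} [Field F]

lemma mulVec_blockDiagonal' {ι : Type*} [Fintype ι] [DecidableEq ι] {m n : ι → Type*}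
    [∀ i, Fintype (n i)] (M : ∀ i, Matrix (m i) (n i) F) (v : (Σ i, n i) → F) (i : ι) (x : m i) :
    (blockDiagonal' M *ᵥ v) ⟨i, x⟩ = (M i *ᵥ fun y => v ⟨i, y⟩) x := by
  simp only [mulVec, dotProduct, Fintype.sum_sigma]
  rw [Finset.sum_eq_single i]
  · simp [blockDiagonal'_apply_eq]
  · intro j _ hj
    simp [blockDiagonal'_apply_ne _ _ _ (Ne.symm hj)]
  · simp

/-- The range of a block diagonal matrix is the product of the ranges of its blocks. -/
lemma rank_blockDiagonal' {ι : Type*} [Fintype ι] [DecidableEq ι] {m n : ι → Type*}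
    [∀ i, Fintype (m i)] [∀ i, Fintype (n i)] (M : ∀ i, Matrix (m i) (n i) F) :
    (blockDiagonal' M).rank = ∑ i, (M i).rank := by
  let φ : (∀ i, LinearMap.range (M i).mulVecLin) →ₗ[F] ((Σ i, m i) → F) :=
    { toFun := fun f x => (f x.1 : m x.1 → F) x.2
      map_add' := fun f g => rfl
      map_smul' := fun c f => rfl }
  have hφ : Function.Injective φ := by
    intro f g h
    ext i x
    exact congrFun h ⟨i, x⟩
  have hr : LinearMap.range φ = LinearMap.range (blockDiagonal' M).mulVecLin := by
    apply le_antisymm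
    · rintro _ ⟨f, rfl⟩
      choose v hv using fun i => (f i).2
      refine ⟨fun x => v x.1 x.2, ?_⟩
      ext ⟨i, x⟩
      rw [mulVecLin_apply, mulVec_blockDiagonal']
      exact congrFun (hv i) x
    · rintro _ ⟨v, rfl⟩
      refine ⟨fun i => ⟨_, ⟨fun y => v ⟨i, y⟩, rfl⟩⟩, ?_⟩
      ext ⟨i, x⟩
      rw [mulVecLin_apply, mulVec_blockDiagonal']
      rfl
  rw [rank, ← hr, LinearMap.finrank_range_of_inj hφ, Module.finrank_pi_fintype]
  rfl

lemma rank_fromBlocks_zero {l m n o : Type*} [Fintype l] [Fintype m] [Fintype n] [Fintype o]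
    (A : Matrix n l F) (D : Matrix o m F) :
    (fromBlocks A 0 0 D).rank = A.rank + D.rank := by
  let φ : (LinearMap.range A.mulVecLin × LinearMap.range D.mulVecLin) →ₗ[F] (n ⊕ o → F) :=
    { toFun := fun f => Sum.elim (f.1 : n → F) (f.2 : o → F)
      map_add' := fun f g => by ext (i | i) <;> rfl
      map_smul' := fun c f => by ext (i | i) <;> rfl }
  have hφ : Function.Injective φ := by
    intro f g h
    ext x
    · exact congrFun h (Sum.inl x)
    · exact congrFun h (Sum.inr x)
  have hr : LinearMap.range φ = LinearMap.range (fromBlocks A 0 0 D).mulVecLin := by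
    apply le_antisymm
    · rintro _ ⟨⟨⟨_, v, rfl⟩, ⟨_, w, rfl⟩⟩, rfl⟩
      refine ⟨Sum.elim v w, ?_⟩
      ext (i | i) <;> simp [fromBlocks_mulVec, φ]
    · rintro _ ⟨v, rfl⟩
      refine ⟨⟨⟨_, ⟨v ∘ Sum.inl, rfl⟩⟩, ⟨_, ⟨v ∘ Sum.inr, rfl⟩⟩⟩, ?_⟩
      ext (i | i) <;> simp [fromBlocks_mulVec, φ]
  rw [rank, ← hr, LinearMap.finrank_range_of_inj hφ, Module.finrank_prod]
  rfl

/-- The `m × n` matrix with ones on the `s`-th subdiagonal and zeros elsewhere. All alternating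
products of the blocks of a `PairBlock` are of this form. -/
def shiftMat (F : Type*) [Field F] (m n s : ℕ) : Matrix (Fin m) (Fin n) F :=
  Matrix.of fun i j => if (i : ℕ) = (j : ℕ) + s then 1 else 0

lemma shiftMat_zero_eq_one (n : ℕ) : shiftMat F n n 0 = 1 := by
  ext i j
  simp [shiftMat, one_apply, Fin.ext_iff]

lemma shiftMat_mul {m n p s t : ℕ} (h : m ≤ n + s) :
    shiftMat F m n s * shiftMat F n p t = shiftMat F m p (t + s) := by
  ext i j
  rw [mul_apply]
  by_cases hj : (j : ℕ) + t < n
  · rw [Finset.sum_eq_single ⟨(j : ℕ) + t, hj⟩]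
    · simp [shiftMat, add_assoc]
    · intro k _ hk
      have : ¬ (k : ℕ) = j + t := fun h => hk (Fin.ext h)
      simp [shiftMat, this]
    · simp
  · rw [Finset.sum_eq_zero]
    · have := i.2
      have : ¬ (i : ℕ) = j + (t + s) := by omega
      simp [shiftMat, this]
    · intro k _
      have := k.2
      have : ¬ (k : ℕ) = j + t := by omega
      simp [shiftMat, this]

lemma shiftMat_pow (n s k : ℕ) : shiftMat F n n s ^ k = shiftMat F n n (k * s) := by
  induction k with
  | zero => simp [shiftMat_zero_eq_one]
  | succ k ih => rw [pow_succ, ih, shiftMat_mul (by omega)]; congr 1; ring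

lemma rank_shiftMat (m n s : ℕ) : (shiftMat F m n s).rank = min n (m - s) := by
  apply le_antisymm
  · -- the matrix factors through the space of dimension `min n (m - s)`
    have : shiftMat F m n s = shiftMat F m (min n (m - s)) s * shiftMat F (min n (m - s)) n 0 := by
      ext i j
      rw [mul_apply]
      by_cases hj : (j : ℕ) < min n (m - s)
      · rw [Finset.sum_eq_single ⟨(j : ℕ), hj⟩]
        · simp [shiftMat]
        · intro k _ hk
          have : ¬ (k : ℕ) = j := fun h => hk (Fin.ext h)
          simp [shiftMat, this]
        · simp
      · rw [Finset.sum_eq_zero]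
        · have := i.2
          have := j.2
          have : ¬ (i : ℕ) = j + s := by omega
          simp [shiftMat, this]
        · intro k _
          have := k.2
          have : ¬ (k : ℕ) = j := by omega
          simp [shiftMat, this]
    rw [this]
    exact (rank_mul_le_left _ _).trans (rank_le_width _)
  · have h : (shiftMat F m n s).submatrix
        (fun i : Fin (min n (m - s)) => (⟨i + s, by have := i.2; omega⟩ : Fin m))
        (fun i : Fin (min n (m - s)) => (⟨i, by have := i.2; omega⟩ : Fin n)) = 1 := by
      ext i j
      simp [shiftMat, one_apply, Fin.ext_iff]
    have := rank_submatrix_le (shiftMat F m n s)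
        (fun i : Fin (min n (m - s)) => (⟨i + s, by have := i.2; omega⟩ : Fin m))
        (fun i : Fin (min n (m - s)) => (⟨i, by have := i.2; omega⟩ : Fin n))
    rwa [h, rank_one, Fintype.card_fin] at this

end Rank

/-! ### Ranks of alternating products in the canonical form -/

section Words

variable {F : Type*} [Field F]

/-- The shift of the block `A_i`: it is `0` if the chain of basis vectors described by the pair
of blocks starts in `V`, and `1` if it starts in `W`. -/
def PairBlock.lagA : PairBlock → ℕ
  | ⟨.wide, _, _⟩ => 0
  | ⟨.tall, _, _⟩ => 1
  | ⟨.idShift, _, _⟩ => 0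
  | ⟨.shiftId, _, _⟩ => 1

/-- The shift of the block `B_i`. -/
def PairBlock.lagB : PairBlock → ℕ
  | ⟨.wide, _, _⟩ => 1
  | ⟨.tall, _, _⟩ => 0
  | ⟨.idShift, _, _⟩ => 1
  | ⟨.shiftId, _, _⟩ => 0

lemma PairBlock.matA_eq (b : PairBlock) : b.matA F = shiftMat F b.rows b.cols b.lagA := by
  rcases b with ⟨_ | _, _, _⟩ <;> rfl

lemma PairBlock.matB_eq (b : PairBlock) : b.matB F = shiftMat F b.cols b.rows b.lagB := by
  rcases b with ⟨_ | _, _, _⟩ <;> rfl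

lemma PairBlock.lag_add (b : PairBlock) : b.lagA + b.lagB = 1 := by
  rcases b with ⟨_ | _, _, _⟩ <;> rfl

lemma PairBlock.rows_le (b : PairBlock) : b.rows ≤ b.cols + b.lagA := by
  rcases b with ⟨_ | _, _, _⟩ <;> simp [rows, cols, lagA]

lemma PairBlock.cols_le (b : PairBlock) : b.cols ≤ b.rows + b.lagB := by
  rcases b with ⟨_ | _, _, _⟩ <;> simp [rows, cols, lagB]

lemma PairBlock.matB_mul_matA_pow (b : PairBlock) (k : ℕ) :
    (b.matB F * b.matA F) ^ k = shiftMat F b.cols b.cols k := by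
  rw [matA_eq, matB_eq, shiftMat_mul b.cols_le, lag_add, shiftMat_pow, mul_one]

lemma PairBlock.matA_mul_matB_pow (b : PairBlock) (k : ℕ) :
    (b.matA F * b.matB F) ^ k = shiftMat F b.rows b.rows k := by
  rw [matA_eq, matB_eq, shiftMat_mul b.rows_le, add_comm, lag_add, shiftMat_pow, mul_one]

lemma PairBlock.rank_matA_word (b : PairBlock) (k : ℕ) :
    (b.matA F * (b.matB F * b.matA F) ^ k).rank = b.rows - (k + b.lagA) := by
  rw [matB_mul_matA_pow, matA_eq, shiftMat_mul b.rows_le, rank_shiftMat]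
  have := b.rows_le
  omega

lemma PairBlock.rank_matB_word (b : PairBlock) (k : ℕ) :
    (b.matB F * (b.matA F * b.matB F) ^ k).rank = b.cols - (k + b.lagB) := by
  rw [matA_mul_matB_pow, matB_eq, shiftMat_mul b.cols_le, rank_shiftMat]
  have := b.cols_le
  omega

variable (L : List (JordanBlock F)) (P : List PairBlock) (r c : ℕ)

lemma canonB_mul_canonA_pow (k : ℕ) : (canonB L P r c * canonA L P r c) ^ k =
    fromBlocks (jordanMat L ^ k) 0 0 (fromBlocks
      (blockDiagonal' fun i => ((P.get i).matB F * (P.get i).matA F) ^ k) 0 0 (0 ^ k)) := by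
  have : canonB L P r c * canonA L P r c = fromBlocks (jordanMat L) 0 0 (fromBlocks
      (blockDiagonal' fun i => ((P.get i).matB F * (P.get i).matA F)) 0 0 0) := by
    simp [canonA, canonB, fromBlocks_multiply, blockDiagonal'_mul]
  rw [this, fromBlocks_diagonal_pow, fromBlocks_diagonal_pow, ← blockDiagonal'_pow]
  rfl

lemma canonA_mul_canonB : canonA L P r c * canonB L P r c =
    fromBlocks (jordanMat L) 0 0 (fromBlocks
      (blockDiagonal' fun i => ((P.get i).matA F * (P.get i).matB F)) 0 0 0) := by
  simp [canonA, canonB, fromBlocks_multiply, blockDiagonal'_mul]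

lemma canonA_mul_canonB_pow (k : ℕ) : (canonA L P r c * canonB L P r c) ^ k =
    fromBlocks (jordanMat L ^ k) 0 0 (fromBlocks
      (blockDiagonal' fun i => ((P.get i).matA F * (P.get i).matB F) ^ k) 0 0 (0 ^ k)) := by
  rw [canonA_mul_canonB, fromBlocks_diagonal_pow, fromBlocks_diagonal_pow, ← blockDiagonal'_pow]
  rfl

lemma sum_get_eq {α : Type*} (l : List α) (f : α → ℕ) : ∑ i, f (l.get i) = (l.map f).sum := by
  rw [← List.sum_ofFn]
  congr 1
  exact List.ext_getElem (by simp) (by simp)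

variable (hJ : IsUnit (jordanMat L))
include hJ

lemma rank_canonA_word (k : ℕ) :
    (canonA L P r c * (canonB L P r c * canonA L P r c) ^ k).rank =
      Fintype.card (JordanIdx L) + (P.map fun b => b.rows - (k + b.lagA)).sum := by
  rw [canonB_mul_canonA_pow, canonA, fromBlocks_multiply]
  simp only [Matrix.one_mul, Matrix.mul_zero, Matrix.zero_mul, add_zero, zero_add,
    fromBlocks_multiply, ← blockDiagonal'_mul]
  rw [rank_fromBlocks_zero, rank_fromBlocks_zero, rank_of_isUnit _ (hJ.pow k), rank_zero,
    rank_blockDiagonal', add_zero]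
  simp_rw [PairBlock.rank_matA_word]
  rw [sum_get_eq P fun b => b.rows - (k + b.lagA)]

lemma rank_canonB_word (k : ℕ) :
    (canonB L P r c * (canonA L P r c * canonB L P r c) ^ k).rank =
      Fintype.card (JordanIdx L) + (P.map fun b => b.cols - (k + b.lagB)).sum := by
  rw [canonA_mul_canonB_pow, canonB, fromBlocks_multiply]
  simp only [Matrix.mul_zero, Matrix.zero_mul, add_zero, zero_add,
    fromBlocks_multiply, ← blockDiagonal'_mul]
  rw [rank_fromBlocks_zero, rank_fromBlocks_zero, rank_of_isUnit _ (hJ.mul (hJ.pow k)), rank_zero,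
    rank_blockDiagonal', add_zero]
  simp_rw [PairBlock.rank_matB_word]
  rw [sum_get_eq P fun b => b.cols - (k + b.lagB)]

lemma rank_canonBA_pow (k : ℕ) :
    ((canonB L P r c * canonA L P r c) ^ k).rank =
      Fintype.card (JordanIdx L) + (P.map fun b => b.cols - k).sum + if k = 0 then c else 0 := by
  rw [canonB_mul_canonA_pow, rank_fromBlocks_zero, rank_fromBlocks_zero,
    rank_of_isUnit _ (hJ.pow k), rank_blockDiagonal', ← add_assoc]
  simp_rw [PairBlock.matB_mul_matA_pow, rank_shiftMat]
  rw [sum_get_eq P fun b => min b.cols (b.cols - k)]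
  congr 2
  · congr 2; ext b; omega
  · split_ifs with h
    · simp [h]
    · simp [zero_pow h]

lemma rank_canonAB_pow (k : ℕ) :
    ((canonA L P r c * canonB L P r c) ^ k).rank =
      Fintype.card (JordanIdx L) + (P.map fun b => b.rows - k).sum + if k = 0 then r else 0 := by
  rw [canonA_mul_canonB_pow, rank_fromBlocks_zero, rank_fromBlocks_zero,
    rank_of_isUnit _ (hJ.pow k), rank_blockDiagonal', ← add_assoc]
  simp_rw [PairBlock.matA_mul_matB_pow, rank_shiftMat]
  rw [sum_get_eq P fun b => min b.rows (b.rows - k)]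
  congr 2
  · congr 2; ext b; omega
  · split_ifs with h
    · simp [h]
    · simp [zero_pow h]

end Words

/-! ### The blocks are determined by the ranks -/

section Counting

open Classical in
/-- If `x_ℓ` and `y_ℓ` are the ranks of the alternating products of `ℓ` factors that start in `V`
and in `W`, then `y_ℓ - x_{ℓ+1}` is the number of chains of more than `ℓ` vectors that start in `W`.
So the number of chains of each kind is a combination of ranks, in which the size of the nonsingular
part cancels. -/
lemma perm_of_word_ranks {P P' : List PairBlock} {n n' r r' c c' : ℕ}
    (hA : ∀ k, n + (P.map fun b => b.rows - (k + b.lagA)).sum =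
      n' + (P'.map fun b => b.rows - (k + b.lagA)).sum)
    (hB : ∀ k, n + (P.map fun b => b.cols - (k + b.lagB)).sum =
      n' + (P'.map fun b => b.cols - (k + b.lagB)).sum)
    (hAB : ∀ k, n + (P.map fun b => b.rows - k).sum + (if k = 0 then r else 0) =
      n' + (P'.map fun b => b.rows - k).sum + if k = 0 then r' else 0)
    (hBA : ∀ k, n + (P.map fun b => b.cols - k).sum + (if k = 0 then c else 0) =
      n' + (P'.map fun b => b.cols - k).sum + if k = 0 then c' else 0) :
    P.Perm P' ∧ r = r' ∧ c = c' := by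
  -- the number of chains of a given type is a second difference of the ranks
  have tall (P : List PairBlock) (k : ℕ) (hk : 0 < k) :
      (P.map fun b => b.rows - k).sum + (P.map fun b => b.cols - (k + 1)).sum =
      (P.map fun b => b.rows - (k + b.lagA)).sum + (P.map fun b => b.cols - (k + b.lagB)).sum
        + P.count ⟨.tall, k, hk⟩ := by
    induction P with
    | nil => simp
    | cons b P ih =>
      rw [List.count_cons]
      rcases b with ⟨_ | _, j, hj⟩ <;>
        simp [PairBlock.rows, PairBlock.cols, PairBlock.lagA, PairBlock.lagB] at ih ⊢ <;>
        (try split_ifs) <;> omega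
  have wide (P : List PairBlock) (k : ℕ) (hk : 0 < k) :
      (P.map fun b => b.cols - k).sum + (P.map fun b => b.rows - (k + 1)).sum =
      (P.map fun b => b.rows - (k + b.lagA)).sum + (P.map fun b => b.cols - (k + b.lagB)).sum
        + P.count ⟨.wide, k, hk⟩ := by
    induction P with
    | nil => simp
    | cons b P ih =>
      rw [List.count_cons]
      rcases b with ⟨_ | _, j, hj⟩ <;>
        simp [PairBlock.rows, PairBlock.cols, PairBlock.lagA, PairBlock.lagB] at ih ⊢ <;>
        (try split_ifs) <;> omega
  have shiftId (P : List PairBlock) (k : ℕ) :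
      (P.map fun b => b.rows - ((k + 1) + b.lagA)).sum +
        (P.map fun b => b.cols - (k + b.lagB)).sum =
      (P.map fun b => b.rows - (k + 1)).sum + (P.map fun b => b.cols - (k + 1)).sum
        + P.count ⟨.shiftId, k + 1, k.succ_pos⟩ := by
    induction P with
    | nil => simp
    | cons b P ih =>
      rw [List.count_cons]
      rcases b with ⟨_ | _, j, hj⟩ <;>
        simp [PairBlock.rows, PairBlock.cols, PairBlock.lagA, PairBlock.lagB] at ih ⊢ <;>
        (try split_ifs) <;> omega
  have idShift (P : List PairBlock) (k : ℕ) :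
      (P.map fun b => b.rows - (k + b.lagA)).sum +
        (P.map fun b => b.cols - ((k + 1) + b.lagB)).sum =
      (P.map fun b => b.rows - (k + 1)).sum + (P.map fun b => b.cols - (k + 1)).sum
        + P.count ⟨.idShift, k + 1, k.succ_pos⟩ := by
    induction P with
    | nil => simp
    | cons b P ih =>
      rw [List.count_cons]
      rcases b with ⟨_ | _, j, hj⟩ <;>
        simp [PairBlock.rows, PairBlock.cols, PairBlock.lagA, PairBlock.lagB] at ih ⊢ <;>
        (try split_ifs) <;> omega
  -- a block `0` is a chain of length one
  have zero₁ (P : List PairBlock) :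
      (P.map fun b => b.rows - 0).sum + (P.map fun b => b.cols - 1).sum =
      (P.map fun b => b.rows - (0 + b.lagA)).sum + (P.map fun b => b.cols - (0 + b.lagB)).sum := by
    induction P with
    | nil => simp
    | cons b P ih =>
      rcases b with ⟨_ | _, j, hj⟩ <;>
        simp [PairBlock.rows, PairBlock.cols, PairBlock.lagA, PairBlock.lagB] at ih ⊢ <;> omega
  have zero₂ (P : List PairBlock) :
      (P.map fun b => b.cols - 0).sum + (P.map fun b => b.rows - 1).sum =
      (P.map fun b => b.rows - (0 + b.lagA)).sum + (P.map fun b => b.cols - (0 + b.lagB)).sum := by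
    induction P with
    | nil => simp
    | cons b P ih =>
      rcases b with ⟨_ | _, j, hj⟩ <;>
        simp [PairBlock.rows, PairBlock.cols, PairBlock.lagA, PairBlock.lagB] at ih ⊢ <;> omega
  have hAB' (k : ℕ) (hk : 0 < k) := by simpa [hk.ne'] using hAB k
  have hBA' (k : ℕ) (hk : 0 < k) := by simpa [hk.ne'] using hBA k
  refine ⟨List.perm_iff_count.2 ?_, ?_, ?_⟩
  · rintro ⟨_ | _, k, hk⟩
    · have := hA k; have := hB k; have := hBA' k hk; have := hAB' (k + 1) k.succ_pos
      have := wide P k hk; have := wide P' k hk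
      omega
    · have := hA k; have := hB k; have := hAB' k hk; have := hBA' (k + 1) k.succ_pos
      have := tall P k hk; have := tall P' k hk
      omega
    · obtain ⟨k, rfl⟩ := Nat.exists_eq_succ_of_ne_zero hk.ne'
      have := hA k; have := hB (k + 1); have := hAB' (k + 1) hk; have := hBA' (k + 1) hk
      have := idShift P k; have := idShift P' k
      simp only [Nat.succ_eq_add_one]
      omega
    · obtain ⟨k, rfl⟩ := Nat.exists_eq_succ_of_ne_zero hk.ne'
      have := hA (k + 1); have := hB k; have := hAB' (k + 1) hk; have := hBA' (k + 1) hk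
      have := shiftId P k; have := shiftId P' k
      simp only [Nat.succ_eq_add_one]
      omega
  · have := hA 0; have := hB 0; have := hAB 0; have := hBA' 1 one_pos
    have := zero₁ P; have := zero₁ P'
    simp only [if_true] at *
    omega
  · have := hA 0; have := hB 0; have := hBA 0; have := hAB' 1 one_pos
    have := zero₂ P; have := zero₂ P'
    simp only [if_true] at *
    omega

/-- Ranks of alternating products of at most `2t` factors suffice if no block has more than `t`
rows and more than `t` columns, since longer products vanish on all blocks. -/
lemma perm_of_bounded_word_ranks {P P' : List PairBlock} {n r r' c c' t : ℕ}
    (hP : ∀ b ∈ P, b.rows ≤ t ∨ b.cols ≤ t) (hP' : ∀ b ∈ P', b.rows ≤ t ∨ b.cols ≤ t)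
    (hA : ∀ k < t, n + (P.map fun b => b.rows - (k + b.lagA)).sum =
      n + (P'.map fun b => b.rows - (k + b.lagA)).sum)
    (hB : ∀ k < t, n + (P.map fun b => b.cols - (k + b.lagB)).sum =
      n + (P'.map fun b => b.cols - (k + b.lagB)).sum)
    (hAB : ∀ k ≤ t, n + (P.map fun b => b.rows - k).sum + (if k = 0 then r else 0) =
      n + (P'.map fun b => b.rows - k).sum + if k = 0 then r' else 0)
    (hBA : ∀ k ≤ t, n + (P.map fun b => b.cols - k).sum + (if k = 0 then c else 0) =
      n + (P'.map fun b => b.cols - k).sum + if k = 0 then c' else 0) :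
    P.Perm P' ∧ r = r' ∧ c = c' := by
  have vanish (f : PairBlock → ℕ) (P : List PairBlock) (h : ∀ b ∈ P, f b = 0) :
      (P.map f).sum = 0 := by
    rw [List.sum_eq_zero]
    intro x hx
    obtain ⟨b, hb, rfl⟩ := List.mem_map.1 hx
    exact h b hb
  refine perm_of_word_ranks (n := n) (n' := n) (fun k => ?_) (fun k => ?_) (fun k => ?_)
    (fun k => ?_)
  · by_cases hk : k < t
    · exact hA k hk
    · rw [vanish _ P, vanish _ P'] <;> intro b hb
      · have := hP' b hb; have := b.rows_le; have := b.cols_le; have := b.lag_add; omega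
      · have := hP b hb; have := b.rows_le; have := b.cols_le; have := b.lag_add; omega
  · by_cases hk : k < t
    · exact hB k hk
    · rw [vanish _ P, vanish _ P'] <;> intro b hb
      · have := hP' b hb; have := b.rows_le; have := b.cols_le; have := b.lag_add; omega
      · have := hP b hb; have := b.rows_le; have := b.cols_le; have := b.lag_add; omega
  · by_cases hk : k ≤ t
    · exact hAB k hk
    · have hk0 : k ≠ 0 := by omega
      rw [vanish _ P, vanish _ P'] <;> intros
      · simp [hk0]
      · have := hP' _ ‹_›; rename_i b _; have := b.rows_le; have := b.lag_add; omega
      · have := hP _ ‹_›; rename_i b _; have := b.rows_le; have := b.lag_add; omega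
  · by_cases hk : k ≤ t
    · exact hBA k hk
    · have hk0 : k ≠ 0 := by omega
      rw [vanish _ P, vanish _ P'] <;> intros
      · simp [hk0]
      · have := hP' _ ‹_›; rename_i b _; have := b.cols_le; have := b.lag_add; omega
      · have := hP _ ‹_›; rename_i b _; have := b.cols_le; have := b.lag_add; omega

end Counting

/-! ### Polynomials in a Jordan block -/

section JordanRank

variable {F : Type*} [Field F]

lemma JordanBlock.natDegree_pos (b : JordanBlock F) : 0 < b.poly.natDegree :=
  b.irreducible.natDegree_pos

/-- The columns of a Jordan block: multiplication by `x` moves `f ^ a * x ^ i` to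
`f ^ a * x ^ (i + 1)`, which for `i + 1 = deg f` is rewritten by means of `f`. -/
lemma JordanBlock.sum_mat_smul {U : Type*} [AddCommGroup U] [Module F U] (b : JordanBlock F)
    (E : ℕ → ℕ → U) (h0 : E b.mult 0 = 0) (y : b.Idx) :
    ∑ x, b.mat x y • E x.1 x.2 =
      if (y.2 : ℕ) + 1 = b.poly.natDegree then
        -(∑ i ∈ Finset.range b.poly.natDegree, b.poly.coeff i • E y.1 i) + E (y.1 + 1) 0
      else E y.1 (y.2 + 1) := by
  obtain ⟨a, i⟩ := y
  have hd := b.natDegree_pos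
  simp only [JordanBlock.mat, Matrix.add_apply, add_smul, Finset.sum_add_distrib, kronecker_apply,
    Fintype.sum_prod_type]
  have h1 : ∑ x : Fin b.mult, ∑ j : Fin b.poly.natDegree,
      ((1 : Matrix (Fin b.mult) (Fin b.mult) F) x a * companionMat b.poly j i) • E x j =
      ∑ j : Fin b.poly.natDegree, companionMat b.poly j i • E a j := by
    rw [Finset.sum_eq_single a]
    · simp
    · intro x _ hx
      simp [one_apply_ne hx]
    · simp
  have h2 : ∑ x : Fin b.mult, ∑ j : Fin b.poly.natDegree,
      (subdiagMat F b.mult b.mult x a * cornerMat F b.poly.natDegree j i) • E x j =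
      if (i : ℕ) + 1 = b.poly.natDegree then E (a + 1) 0 else 0 := by
    split_ifs with hi
    · by_cases ha : (a : ℕ) + 1 < b.mult
      · rw [Finset.sum_eq_single ⟨a + 1, ha⟩, Finset.sum_eq_single ⟨0, hd⟩]
        · simp [subdiagMat, cornerMat, hi]
        · intro j _ hj
          have : ¬ (j : ℕ) = 0 := fun h => hj (Fin.ext h)
          simp [cornerMat, this]
        · simp
        · intro x _ hx
          have : ¬ (x : ℕ) = a + 1 := fun h => hx (Fin.ext h)
          simp [subdiagMat, this]
        · simp
      · have ha' : (a : ℕ) + 1 = b.mult := by have := a.2; omega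
        rw [ha', h0]
        refine Finset.sum_eq_zero fun x _ => Finset.sum_eq_zero fun j _ => ?_
        have : ¬ (x : ℕ) = a + 1 := by have := x.2; omega
        simp [subdiagMat, this]
    · refine Finset.sum_eq_zero fun x _ => Finset.sum_eq_zero fun j _ => ?_
      simp [cornerMat, hi]
  rw [h1, h2]
  split_ifs with hi
  · rw [Finset.sum_range, ← Finset.sum_neg_distrib]
    simp [companionMat, hi]
  · have hi' : (i : ℕ) + 1 < b.poly.natDegree := by have := i.2; omega
    rw [add_zero, Finset.sum_eq_single ⟨i + 1, hi'⟩]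
    · simp [companionMat, hi]
    · intro j _ hj
      have : ¬ (j : ℕ) = i + 1 := fun h => hj (Fin.ext h)
      simp [companionMat, hi, this]
    · simp

/-- The prime `f` acts on its Jordan block by moving `f ^ a * x ^ i` to `f ^ (a + 1) * x ^ i`. -/
lemma JordanBlock.aeval_poly (b : JordanBlock F) :
    aeval b.mat b.poly = subdiagMat F b.mult b.mult ⊗ₖ
      (1 : Matrix (Fin b.poly.natDegree) (Fin b.poly.natDegree) F) := by
  let E : ℕ → ℕ → (b.Idx → F) := fun a i x => if (x.1 : ℕ) = a ∧ (x.2 : ℕ) = i then 1 else 0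
  have hE (y : b.Idx) : E y.1 y.2 = Pi.single y 1 := by
    ext x
    simp [E, Pi.single_apply, Prod.ext_iff, Fin.ext_iff]
  have h0 (i : ℕ) : E b.mult i = 0 := by
    ext x
    have := x.1.2.ne
    simp [E, this]
  have hM (y : b.Idx) : b.mat *ᵥ E y.1 y.2 = ∑ x, b.mat x y • E x.1 x.2 := by
    rw [hE, mulVec_single_one]
    ext x
    simp [hE, Finset.sum_apply, Pi.single_apply]
  have hd := b.natDegree_pos
  have hpow (a i : ℕ) (ha : a ≤ b.mult) (hi : i < b.poly.natDegree) :
      b.mat ^ i *ᵥ E a 0 = E a i := by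
    rcases ha.eq_or_lt with rfl | ha
    · simp [h0]
    induction i with
    | zero => simp
    | succ i ih =>
      rw [pow_succ', ← mulVec_mulVec, ih (by omega), hM (⟨a, ha⟩, ⟨i, by omega⟩),
        b.sum_mat_smul E (h0 0), if_neg hi.ne]
  have hpoly (a : ℕ) (ha : a < b.mult) : aeval b.mat b.poly *ᵥ E a 0 = E (a + 1) 0 := by
    have htop : b.mat ^ b.poly.natDegree *ᵥ E a 0 =
        -(∑ i ∈ Finset.range b.poly.natDegree, b.poly.coeff i • E a i) + E (a + 1) 0 := by
      obtain ⟨d, hd'⟩ := Nat.exists_eq_succ_of_ne_zero hd.ne'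
      have hlt : d < b.poly.natDegree := by omega
      rw [show b.mat ^ b.poly.natDegree = b.mat ^ (d + 1) from congrArg _ hd', pow_succ',
        ← mulVec_mulVec, hpow a d ha.le hlt, hM (⟨a, ha⟩, ⟨d, hlt⟩),
        b.sum_mat_smul E (h0 0), if_pos hd'.symm]
    rw [aeval_eq_sum_range, Finset.sum_range_succ, b.monic.coeff_natDegree, one_smul, add_mulVec,
      htop, sum_mulVec, Finset.sum_congr rfl fun i hi => by
        rw [smul_mulVec, hpow a i ha.le (Finset.mem_range.1 hi)]]
    abel
  have hcol (y : b.Idx) : aeval b.mat b.poly *ᵥ Pi.single y 1 = E (y.1 + 1) y.2 := by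
    have hcomm : aeval b.mat b.poly * b.mat ^ (y.2 : ℕ) =
        b.mat ^ (y.2 : ℕ) * aeval b.mat b.poly := by
      have := congrArg (aeval b.mat) (mul_comm b.poly (X ^ (y.2 : ℕ)))
      rwa [map_mul, map_mul, map_pow, aeval_X] at this
    rw [← hE, ← hpow y.1 y.2 y.1.2.le y.2.2, mulVec_mulVec, hcomm, ← mulVec_mulVec,
      hpoly _ y.1.2, hpow _ _ y.1.2 y.2.2]
  ext x y
  have := congrFun (hcol y) x
  rw [mulVec_single_one] at this
  rw [← col_apply (aeval b.mat b.poly), this]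
  rw [show subdiagMat F b.mult b.mult ⊗ₖ (1 : Matrix (Fin b.poly.natDegree)
    (Fin b.poly.natDegree) F) = of fun x y : b.Idx => subdiagMat F b.mult b.mult x.1 y.1 *
      (1 : Matrix (Fin b.poly.natDegree) (Fin b.poly.natDegree) F) x.2 y.2 from rfl]
  simp only [E, subdiagMat, of_apply, one_apply, Fin.ext_iff, ite_mul, zero_mul, one_mul, ite_and]

lemma JordanBlock.aeval_poly_pow (b : JordanBlock F) (j : ℕ) :
    aeval b.mat (b.poly ^ j) = shiftMat F b.mult b.mult j ⊗ₖ
      (1 : Matrix (Fin b.poly.natDegree) (Fin b.poly.natDegree) F) := by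
  rw [map_pow, b.aeval_poly]
  induction j with
  | zero => rw [pow_zero, shiftMat_zero_eq_one, one_kronecker_one]
  | succ j ih =>
    rw [pow_succ, ih, ← mul_kronecker_mul, Matrix.one_mul, show subdiagMat F b.mult b.mult =
      shiftMat F b.mult b.mult 1 from rfl, shiftMat_mul (by omega), add_comm]

lemma rank_kronecker_one {m n : Type*} [Fintype m] [Fintype n] (d : ℕ) (M : Matrix m n F) :
    (M ⊗ₖ (1 : Matrix (Fin d) (Fin d) F)).rank = d * M.rank := by
  rw [kronecker_one, ← blockDiagonal'_submatrix_eq_blockDiagonal]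
  have h := rank_submatrix (blockDiagonal' fun _ : Fin d => M)
    ((Equiv.prodComm m (Fin d)).trans (Equiv.sigmaEquivProd (Fin d) m).symm)
    ((Equiv.prodComm n (Fin d)).trans (Equiv.sigmaEquivProd (Fin d) n).symm)
  rw [rank_blockDiagonal', Finset.sum_const, Finset.card_univ, Fintype.card_fin,
    smul_eq_mul] at h
  exact h

/-- If `g(x)` is nilpotent and `f` is prime to `g`, a Bézout relation makes `f(x)` invertible. -/
lemma isUnit_aeval_of_isNilpotent {R : Type*} [Ring R] [Algebra F R] {x : R} {f g : F[X]}
    (h : IsCoprime f g) (hx : IsNilpotent (aeval x g)) : IsUnit (aeval x f) := by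
  obtain ⟨u, v, huv⟩ := h
  have h1 : aeval x u * aeval x f = 1 - aeval x v * aeval x g := by
    rw [eq_sub_iff_add_eq, ← map_mul, ← map_mul, ← map_add, huv, map_one]
  have h2 : IsNilpotent (aeval x v * aeval x g) :=
    ((Commute.all v g).map (aeval x)).isNilpotent_mul_left hx
  have h3 : IsUnit (aeval x u * aeval x f) := h1 ▸ h2.isUnit_one_sub
  exact (((Commute.all u f).map (aeval x)).isUnit_mul_iff.1 h3).2

lemma isCoprime_of_monic_irreducible {f g : F[X]} (hf : f.Monic) (hf' : Irreducible f)
    (hg : g.Monic) (hg' : Irreducible g) (h : f ≠ g) : IsCoprime f g :=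
  (hf'.coprime_iff_not_dvd).2 fun hd => h <|
    eq_of_monic_of_associated hf hg (hf'.associated_of_dvd hg' hd)

lemma JordanBlock.isUnit_aeval (b : JordanBlock F) {f : F[X]} (h : IsCoprime f b.poly) :
    IsUnit (aeval b.mat f) := by
  refine isUnit_aeval_of_isNilpotent h ⟨b.mult, ?_⟩
  rw [← map_pow, b.aeval_poly_pow, show shiftMat F b.mult b.mult b.mult = 0 from ?_,
    zero_kronecker]
  ext i k
  have : ¬ (i : ℕ) = k + b.mult := by have := i.2; omega
  simp [shiftMat, this]

open Classical in
/-- The rank of `f ^ j` on the Jordan block `b`, for a prime `f`. -/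
noncomputable def JordanBlock.polyRank (b : JordanBlock F) (f : F[X]) (j : ℕ) : ℕ :=
  if b.poly = f then f.natDegree * (b.mult - j) else b.mult * b.poly.natDegree

lemma JordanBlock.rank_aeval (b : JordanBlock F) {f : F[X]} (hf : f.Monic) (hf' : Irreducible f)
    (j : ℕ) : (aeval b.mat (f ^ j)).rank = b.polyRank f j := by
  unfold JordanBlock.polyRank
  split_ifs with h
  · subst h
    rw [b.aeval_poly_pow, rank_kronecker_one, rank_shiftMat]
    congr 1
    omega
  · have hu : IsUnit (aeval b.mat (f ^ j)) := by
      rw [map_pow]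
      exact (b.isUnit_aeval (isCoprime_of_monic_irreducible hf hf' b.monic b.irreducible
        (Ne.symm h))).pow j
    rw [rank_of_isUnit _ hu]
    simp

lemma aeval_blockDiagonal' {ι : Type*} [Fintype ι] [DecidableEq ι] {m : ι → Type*}
    [∀ i, Fintype (m i)] [∀ i, DecidableEq (m i)] (M : ∀ i, Matrix (m i) (m i) F) (p : F[X]) :
    aeval (blockDiagonal' M) p = blockDiagonal' fun i => aeval (M i) p := by
  induction p using Polynomial.induction_on' with
  | add p q hp hq => simp only [map_add, hp, hq, ← blockDiagonal'_add]; rfl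
  | monomial n a =>
    simp only [aeval_monomial, ← blockDiagonal'_pow, ← Algebra.smul_def, ← blockDiagonal'_smul]
    rfl

lemma aeval_fromBlocks_zero {m n : Type*} [Fintype m] [DecidableEq m] [Fintype n] [DecidableEq n]
    (M : Matrix m m F) (N : Matrix n n F) (p : F[X]) :
    aeval (fromBlocks M 0 0 N) p = fromBlocks (aeval M p) 0 0 (aeval N p) := by
  induction p using Polynomial.induction_on' with
  | add p q hp hq => simp [map_add, hp, hq, fromBlocks_add]
  | monomial n a =>
    simp [aeval_monomial, ← Algebra.smul_def, fromBlocks_diagonal_pow, fromBlocks_smul]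

lemma rank_aeval_jordanMat (L : List (JordanBlock F)) {f : F[X]} (hf : f.Monic)
    (hf' : Irreducible f) (j : ℕ) :
    (aeval (jordanMat L) (f ^ j)).rank = (L.map fun b => b.polyRank f j).sum := by
  rw [jordanMat, aeval_blockDiagonal', rank_blockDiagonal']
  simp_rw [JordanBlock.rank_aeval _ hf hf']
  exact sum_get_eq L fun b => b.polyRank f j

open Classical in
/-- The number of Jordan blocks of a given type is a second difference of ranks. -/
lemma polyRank_second_difference (L : List (JordanBlock F)) (b : JordanBlock F) {k : ℕ}
    (hk : b.mult = k + 1) :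
    (L.map fun x => x.polyRank b.poly k).sum + (L.map fun x => x.polyRank b.poly (k + 2)).sum =
      2 * (L.map fun x => x.polyRank b.poly (k + 1)).sum + b.poly.natDegree * L.count b := by
  induction L with
  | nil => simp
  | cons x L ih =>
    have : x.polyRank b.poly k + x.polyRank b.poly (k + 2) =
        2 * x.polyRank b.poly (k + 1) + if x = b then b.poly.natDegree else 0 := by
      unfold JordanBlock.polyRank
      by_cases hp : x.poly = b.poly
      · rw [if_pos hp, if_pos hp, if_pos hp]
        by_cases hm : x.mult = b.mult
        · have : x = b := by
            cases x; cases b; simp_all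
          rw [if_pos this, hm, hk, Nat.add_sub_cancel_left, Nat.sub_self,
            Nat.sub_eq_zero_of_le (by omega : k + 1 ≤ k + 2)]
          ring
        · have hne : x ≠ b := fun h => hm (h ▸ rfl)
          rw [if_neg hne, ← mul_add, add_zero, mul_left_comm]
          congr 1
          omega
      · have hne : x ≠ b := fun h => hp (h ▸ rfl)
        rw [if_neg hp, if_neg hp, if_neg hp, if_neg hne]
        ring
    rw [List.count_cons]
    simp only [List.map_cons, List.sum_cons, beq_iff_eq]
    split_ifs at this ⊢ <;> simp only [mul_add] <;> omega

/-- A nonsingular Jordan matrix is determined, up to the order of its blocks, by the ranks of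
`f ^ j` for the primes `f ≠ x`, even if these are known only up to a constant. -/
lemma perm_of_polyRank {L L' : List (JordanBlock F)} (hL : ∀ b ∈ L, b.Nonsingular)
    (hL' : ∀ b ∈ L', b.Nonsingular)
    (h : ∀ f : F[X], f.Monic → Irreducible f → f ≠ X → ∃ C C' : ℕ, ∀ j,
      C + (L.map fun b => b.polyRank f j).sum = C' + (L'.map fun b => b.polyRank f j).sum) :
    L.Perm L' := by
  classical
  rw [List.perm_iff_count]
  intro b
  by_cases hb : b.Nonsingular
  · obtain ⟨C, C', hC⟩ := h b.poly b.monic b.irreducible hb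
    obtain ⟨k, hk⟩ := Nat.exists_eq_succ_of_ne_zero b.mult_pos.ne'
    have h1 := polyRank_second_difference L b hk
    have h2 := polyRank_second_difference L' b hk
    have := hC k
    have := hC (k + 1)
    have := hC (k + 2)
    exact Nat.eq_of_mul_eq_mul_left b.natDegree_pos (by omega)
  · rw [List.count_eq_zero.2 fun h => hb (hL b h), List.count_eq_zero.2 fun h => hb (hL' b h)]

/-- Singular blocks contribute only a constant to the ranks of `f ^ j` for a prime `f ≠ x`. -/
lemma polyRank_nonsingularPart (K : List (JordanBlock F)) {f : F[X]} (hf : f ≠ X) :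
    ∃ C, ∀ j, (K.map fun b => b.polyRank f j).sum =
      C + ((nonsingularPart K).map fun b => b.polyRank f j).sum := by
  induction K with
  | nil => exact ⟨0, by simp [nonsingularPart]⟩
  | cons b K ih =>
    obtain ⟨C, hC⟩ := ih
    by_cases hb : b.Nonsingular
    · refine ⟨C, fun j => ?_⟩
      have : nonsingularPart (b :: K) = b :: nonsingularPart K := by
        simp [nonsingularPart, hb]
      rw [this, List.map_cons, List.sum_cons, hC, List.map_cons, List.sum_cons]
      omega
    · refine ⟨C + b.mult * b.poly.natDegree, fun j => ?_⟩
      have : nonsingularPart (b :: K) = nonsingularPart K := by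
        simp [nonsingularPart, hb]
      have hp : b.poly ≠ f := by
        intro h
        exact hb fun h' => hf (h ▸ h')
      rw [this, List.map_cons, List.sum_cons, hC, JordanBlock.polyRank, if_neg hp]
      omega

lemma isUnit_jordanMat {L : List (JordanBlock F)} (hL : ∀ b ∈ L, b.Nonsingular) :
    IsUnit (jordanMat L) := by
  have h (i : Fin L.length) : IsUnit (L.get i).mat := by
    have := (L.get i).isUnit_aeval (isCoprime_of_monic_irreducible monic_X irreducible_X
      (L.get i).monic (L.get i).irreducible (Ne.symm (hL _ (List.get_mem L i))))
    rwa [aeval_X] at this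
  exact (Pi.isUnit_iff.2 h).map (blockDiagonal'RingHom (fun i => (L.get i).Idx) F)

/-- An invertible Jordan matrix has no block for the prime `x`: such a block would be seen in the
ranks of the powers of the matrix. -/
lemma nonsingular_of_isUnit_jordanMat {L : List (JordanBlock F)} (h : IsUnit (jordanMat L)) :
    ∀ b ∈ L, b.Nonsingular := by
  classical
  intro b hb hX
  obtain ⟨k, hk⟩ := Nat.exists_eq_succ_of_ne_zero b.mult_pos.ne'
  have h1 := polyRank_second_difference L b hk
  have h2 (j : ℕ) : (L.map fun x => x.polyRank b.poly j).sum = Fintype.card (JordanIdx L) := by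
    rw [← rank_aeval_jordanMat L b.monic b.irreducible j, hX, map_pow, aeval_X]
    exact rank_of_isUnit _ (h.pow j)
  rw [h2, h2, h2] at h1
  have h3 : 0 < b.poly.natDegree * L.count b :=
    Nat.mul_pos b.natDegree_pos (List.count_pos_iff.2 hb)
  omega

end JordanRank

/-! ### Reindexing direct sums over lists -/

section Reindex

variable {F : Type*} [Field F]

lemma toMatrix_eq_iff {m n V W : Type*} [Fintype m] [DecidableEq m] [Fintype n] [DecidableEq n]
    [AddCommGroup V] [Module F V] [AddCommGroup W] [Module F W]
    (b : Module.Basis n F V) (b' : Module.Basis m F W) (T : V →ₗ[F] W) (M : Matrix m n F) :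
    LinearMap.toMatrix b b' T = M ↔ ∀ j, T (b j) = ∑ i, M i j • b' i := by
  constructor
  · rintro rfl j
    simp_rw [LinearMap.toMatrix_apply]
    exact (b'.sum_repr _).symm
  · intro h
    ext i j
    rw [LinearMap.toMatrix_apply, h, Module.Basis.repr_sum_self]

/-- Two families of objects that differ by a permutation `σ` of the indices have the same disjoint
union of index types. -/
def sigmaReindex {α κ ι : Type*} {q : κ → α} {p : ι → α} (σ : κ ≃ ι) (h : q = p ∘ σ)
    (R : α → Type*) : (Σ k, R (q k)) ≃ Σ i, R (p i) :=
  (Equiv.sigmaCongrRight fun k => Equiv.cast (congrArg R (congrFun h k))).trans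
    (Equiv.sigmaCongrLeft (β := fun i => R (p i)) σ)

lemma blockDiagonal'_submatrix_sigmaReindex {α κ ι : Type*} [DecidableEq κ] [DecidableEq ι]
    {q : κ → α} {p : ι → α} (σ : κ ≃ ι) (h : q = p ∘ σ) {R C : α → Type*}
    (M : ∀ a, Matrix (R a) (C a) F) :
    (blockDiagonal' fun i => M (p i)).submatrix (sigmaReindex σ h R) (sigmaReindex σ h C) =
      blockDiagonal' fun k => M (q k) := by
  subst h
  ext ⟨k, x⟩ ⟨l, y⟩
  by_cases hkl : k = l
  · subst hkl
    rw [blockDiagonal'_apply_eq]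
    exact blockDiagonal'_apply_eq (fun i => M (p i)) (σ k) x y
  · rw [blockDiagonal'_apply_ne _ _ _ hkl]
    exact blockDiagonal'_apply_ne (fun i => M (p i)) x y (k := σ k) (k' := σ l)
      (fun h => hkl (σ.injective h))

/-- The list of the values of a finite family has the same blocks as the family. -/
lemma exists_list_equiv {α ι : Type*} [Finite ι] (p : ι → α) :
    ∃ (l : List α) (σ : Fin l.length ≃ ι), l.get = p ∘ σ := by
  obtain ⟨n, ⟨e⟩⟩ := Finite.exists_equiv_fin ι
  refine ⟨List.ofFn (p ∘ e.symm), (finCongr List.length_ofFn).trans e.symm, ?_⟩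
  ext i
  simp
  rfl

lemma exists_equiv_of_perm {α : Type*} {l l' : List α} (h : l.Perm l') :
    ∃ σ : Fin l.length ≃ Fin l'.length, l.get = l'.get ∘ σ := by
  induction h with
  | nil => exact ⟨Equiv.refl _, rfl⟩
  | cons a h ih =>
    obtain ⟨σ, hσ⟩ := ih
    refine ⟨(finSuccEquiv _).trans ((Equiv.optionCongr σ).trans (finSuccEquiv _).symm), ?_⟩
    ext i
    refine Fin.cases ?_ (fun i => ?_) i
    · simp
    · simpa using congrFun hσ i
  | swap a b l =>
    refine ⟨Equiv.swap 0 1, ?_⟩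
    ext i
    refine Fin.cases ?_ (fun i => Fin.cases ?_ (fun i => ?_) i) i
    · simp
    · rw [show (Fin.succ 0 : Fin (l.length + 2)) = 1 from rfl]
      simp
    · rw [Function.comp_apply, Equiv.swap_apply_of_ne_of_ne]
      · rfl
      · exact Fin.succ_ne_zero _
      · exact fun h => Fin.succ_ne_zero i (Fin.succ_injective _ h)
  | trans _ _ ih₁ ih₂ =>
    obtain ⟨σ, hσ⟩ := ih₁
    obtain ⟨τ, hτ⟩ := ih₂
    exact ⟨σ.trans τ, by rw [hσ, hτ]; rfl⟩

end Reindex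

/-! ### Existence of the Jordan normal form -/

section JordanExistence

variable {F : Type*} [Field F]

/-- The products `f ^ a * x ^ i` with `a < k` and `i < deg f` form a basis of `F[x] / (f ^ k)`. -/
lemma exists_basis_quotient {p f : F[X]} (hf : f.Monic) (hpf : Associated p f) (k : ℕ) :
    ∃ b : Module.Basis (Fin k × Fin f.natDegree) F (F[X] ⧸ Submodule.span F[X] {p ^ k}),
      ∀ y, b y = Submodule.Quotient.mk (f ^ (y.1 : ℕ) * X ^ (y.2 : ℕ)) := by
  have hspan : Submodule.span F[X] {p ^ k} = Submodule.span F[X] {f ^ k} :=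
    Ideal.span_singleton_eq_span_singleton.2 hpf.pow_pow
  rw [hspan]
  let E : Fin k × Fin f.natDegree → F[X] ⧸ Submodule.span F[X] {f ^ k} :=
    fun y => Submodule.Quotient.mk (f ^ (y.1 : ℕ) * X ^ (y.2 : ℕ))
  have key (n : ℕ) : ∀ a, a + n = k → ∀ q : F[X],
      (Submodule.Quotient.mk (f ^ a * q) : F[X] ⧸ Submodule.span F[X] {f ^ k}) ∈
        Submodule.span F (Set.range E) := by
    induction n with
    | zero =>
      rintro a rfl q
      rw [(Submodule.Quotient.mk_eq_zero _).2
        (Ideal.mem_span_singleton.2 (Dvd.intro q rfl))]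
      exact zero_mem _
    | succ n ih =>
      intro a ha q
      -- expand `q` by division with remainder by `f`
      have hq : f ^ a * q = (∑ i ∈ Finset.range f.natDegree,
          (q %ₘ f).coeff i • (f ^ a * X ^ i)) + f ^ (a + 1) * (q /ₘ f) := by
        have h1 : q %ₘ f = ∑ i ∈ Finset.range f.natDegree, (q %ₘ f).coeff i • X ^ i := by
          by_cases h1 : f = 1
          · subst h1
            simp
          · simpa only [smul_eq_C_mul] using
              as_sum_range_C_mul_X_pow' (p := q %ₘ f) (natDegree_modByMonic_lt q hf h1)
        conv_lhs => rw [← modByMonic_add_div q f, h1]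
        rw [mul_add, Finset.mul_sum, pow_succ, mul_assoc]
        simp_rw [mul_smul_comm]
      rw [hq, Submodule.Quotient.mk_add]
      refine add_mem ?_ (ih (a + 1) (by omega) _)
      rw [← Submodule.mkQ_apply, map_sum]
      refine sum_mem fun i hi => ?_
      rw [Submodule.mkQ_apply, Submodule.Quotient.mk_smul]
      exact Submodule.smul_mem _ _ (Submodule.subset_span
        ⟨(⟨a, by omega⟩, ⟨i, Finset.mem_range.1 hi⟩), rfl⟩)
  have htop : ⊤ ≤ Submodule.span F (Set.range E) := by
    rintro ⟨q⟩ -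
    have := key k 0 (zero_add k) q
    rwa [pow_zero, one_mul] at this
  refine ⟨basisOfTopLeSpanOfCardEqFinrank E htop ?_, fun y => by
    rw [coe_basisOfTopLeSpanOfCardEqFinrank]⟩
  rw [Fintype.card_prod, Fintype.card_fin, Fintype.card_fin]
  exact ((finrank_quotient_span_eq_natDegree (f := f ^ k)).trans (natDegree_pow f k)).symm

lemma dfinsuppBasis_apply {ι : Type*} [DecidableEq ι] {M : ι → Type*} [∀ i, AddCommGroup (M i)]
    [∀ i, Module F (M i)] {η : ι → Type*} (b : ∀ i, Module.Basis (η i) F (M i)) (i : ι) (y : η i) :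
    DFinsupp.basis b ⟨i, y⟩ = DFinsupp.single i (b i y) := by
  rw [Module.Basis.apply_eq_iff]
  change (sigmaFinsuppLequivDFinsupp F).symm (DFinsupp.mapRange (fun i => (b i).repr)
    (fun i => map_zero _) _) = _
  rw [LinearEquiv.symm_apply_eq, DFinsupp.mapRange_single]
  simp

/-- A Jordan form comes from the decomposition of `W`, as an `F[x]`-module on which `x` acts as `T`,
into cyclic modules `F[x] / (f ^ k)` with the bases `f ^ a * x ^ i`. -/
lemma exists_isJordanForm {W : Type*} [AddCommGroup W] [Module F W] [FiniteDimensional F W]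
    (T : W →ₗ[F] W) : ∃ L : List (JordanBlock F), IsJordanForm L T := by
  classical
  obtain ⟨ι, _, p, hp, e, ⟨φ⟩⟩ := Module.equiv_directSum_of_isTorsion
    (R := F[X]) (M := Module.AEval' T) (Module.AEval.isTorsion_of_finiteDimensional F W T)
  let f : ι → F[X] := fun i => normalize (p i)
  have hf (i : ι) : (f i).Monic := monic_normalize (hp i).ne_zero
  have hpf (i : ι) : Associated (p i) (f i) := associated_normalize (p i)
  have hfi (i : ι) : Irreducible (f i) := (hpf i).irreducible (hp i)
  choose b hb using fun i => exists_basis_quotient (hf i) (hpf i) (e i)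
  -- summands with `e i = 0` are trivial and give no Jordan block; `τ` below drops them
  let β : {i // 0 < e i} → JordanBlock F := fun i => ⟨f i, hf i, hfi i, e i, i.2⟩
  let ψ : (DirectSum ι fun i => F[X] ⧸ Submodule.span F[X] {p i ^ e i}) ≃ₗ[F] W :=
    (φ.restrictScalars F).symm.trans (Module.AEval'.of T).symm
  have hψ (u : DirectSum ι fun i => F[X] ⧸ Submodule.span F[X] {p i ^ e i}) :
      T (ψ u) = ψ ((X : F[X]) • u) := by
    change T ((Module.AEval'.of T).symm (φ.symm u)) = (Module.AEval'.of T).symm (φ.symm (X • u))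
    rw [map_smul, Module.AEval'.of_symm_X_smul]
  let w : Module.Basis (Σ i, Fin (e i) × Fin (f i).natDegree) F W :=
    Module.Basis.map (DFinsupp.basis b) ψ
  let G (i : ι) : F[X] →ₗ[F] W := ψ.toLinearMap ∘ₗ
    (DirectSum.lof F ι (fun i => F[X] ⧸ Submodule.span F[X] {p i ^ e i}) i) ∘ₗ
    ((Submodule.span F[X] {p i ^ e i}).mkQ.restrictScalars F)
  have hG (i : ι) (q : F[X]) : T (G i q) = G i (X * q) := by
    refine (hψ _).trans (congrArg ψ ?_)
    exact ((DirectSum.lof F[X] ι (fun i => F[X] ⧸ Submodule.span F[X] {p i ^ e i}) i).map_smul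
      X _).symm
  have hw (i y) : w ⟨i, y⟩ = G i (f i ^ (y.1 : ℕ) * X ^ (y.2 : ℕ)) := by
    refine congrArg ψ ((dfinsuppBasis_apply b i y).trans ?_)
    rw [hb]
    rfl
  let τ : (Σ i, (β i).Idx) ≃ (Σ i, Fin (e i) × Fin (f i).natDegree) := Equiv.ofBijective
    (fun x => ⟨x.1.1, x.2⟩) <| by
      constructor
      · rintro ⟨⟨i, hi⟩, x⟩ ⟨⟨j, hj⟩, y⟩ h
        obtain ⟨rfl, h⟩ := Sigma.mk.inj_iff.1 h
        rw [heq_eq_eq] at h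
        subst h
        rfl
      · rintro ⟨i, x⟩
        exact ⟨⟨⟨i, x.1.pos⟩, x⟩, rfl⟩
  obtain ⟨L, σ, hσ⟩ := exists_list_equiv β
  refine ⟨L, (w.reindex τ.symm).reindex (sigmaReindex σ hσ JordanBlock.Idx).symm, ?_⟩
  have hT : LinearMap.toMatrix (w.reindex τ.symm) (w.reindex τ.symm) T =
      blockDiagonal' fun i => (β i).mat := by
    rw [toMatrix_eq_iff]
    rintro ⟨i, y⟩
    let E : ℕ → ℕ → W := fun a j => G i.1 (f i ^ a * X ^ j)
    have hwE (x : (β i).Idx) : w.reindex τ.symm ⟨i, x⟩ = E x.1 x.2 := by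
      rw [Module.Basis.reindex_apply, Equiv.symm_symm]
      exact hw i.1 x
    have h0 : E (β i).mult 0 = 0 := by
      have : (Submodule.span F[X] {p i ^ e i}).mkQ (f i ^ (e i) * X ^ 0) = 0 := by
        rw [Submodule.mkQ_apply, Submodule.Quotient.mk_eq_zero, pow_zero, mul_one]
        exact Ideal.mem_span_singleton.2 (pow_dvd_pow_of_dvd (hpf i).dvd _)
      simp only [E, G, β, LinearMap.comp_apply, LinearMap.restrictScalars_apply, this, map_zero]
    have hlhs : T (w.reindex τ.symm ⟨i, y⟩) = E y.1 (y.2 + 1) := by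
      rw [hwE, hG, mul_left_comm, ← pow_succ']
    have hrhs : ∑ x, blockDiagonal' (fun i => (β i).mat) x ⟨i, y⟩ • w.reindex τ.symm x =
        ∑ x, (β i).mat x y • E x.1 x.2 := by
      rw [Fintype.sum_sigma, Finset.sum_eq_single i]
      · simp only [blockDiagonal'_apply_eq, hwE]
      · intro j _ hj
        simp [blockDiagonal'_apply_ne _ _ _ hj]
      · simp
    rw [hlhs, hrhs, (β i).sum_mat_smul E h0]
    split_ifs with hy
    · have hd : f i ^ (y.1 : ℕ) * X ^ (f i).natDegree = -(∑ j ∈ Finset.range (f i).natDegree,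
          (f i).coeff j • (f i ^ (y.1 : ℕ) * X ^ j)) + f i ^ ((y.1 : ℕ) + 1) * X ^ 0 := by
        have hs := congrArg (f i ^ (y.1 : ℕ) * ·) (hf i).as_sum
        simp_rw [mul_add, Finset.mul_sum, ← smul_eq_C_mul, mul_smul_comm] at hs
        rw [pow_zero, mul_one, pow_succ, eq_neg_add_iff_add_eq, add_comm]
        exact hs.symm
      rw [hy]
      change G i (f i ^ (y.1 : ℕ) * X ^ (f i).natDegree) = _
      rw [hd, map_add, map_neg, map_sum]
      simp only [map_smul]
      rfl
    · rfl
  have := blockDiagonal'_submatrix_sigmaReindex σ hσ (R := JordanBlock.Idx) (C := JordanBlock.Idx)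
    (fun b : JordanBlock F => b.mat)
  rw [jordanMat, ← this, ← hT]
  ext x y
  simp [LinearMap.toMatrix_apply]

end JordanExistence

/-! ### Matrix representations of pairs of linear maps -/

section Represents

variable {F : Type*} [Field F] {V W : Type*} [AddCommGroup V] [Module F V] [AddCommGroup W]
  [Module F W]

/-- In suitable bases of `V` and `W`, the pair `(A, B)` of linear maps has the matrices
`(M, N)`. -/
def Represents {m n : Type*} [Fintype m] [DecidableEq m] [Fintype n] [DecidableEq n]
    (A : V →ₗ[F] W) (B : W →ₗ[F] V) (M : Matrix m n F) (N : Matrix n m F) : Prop :=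
  ∃ (bV : Module.Basis n F V) (bW : Module.Basis m F W),
    LinearMap.toMatrix bV bW A = M ∧ LinearMap.toMatrix bW bV B = N

variable {m n : Type*} [Fintype m] [DecidableEq m] [Fintype n] [DecidableEq n]
  {A : V →ₗ[F] W} {B : W →ₗ[F] V} {M : Matrix m n F} {N : Matrix n m F}

lemma Represents.submatrix {m' n' : Type*} [Fintype m'] [DecidableEq m'] [Fintype n']
    [DecidableEq n'] (h : Represents A B M N) (e : m' ≃ m) (f : n' ≃ n) :
    Represents A B (M.submatrix e f) (N.submatrix f e) := by
  obtain ⟨bV, bW, rfl, rfl⟩ := h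
  refine ⟨bV.reindex f.symm, bW.reindex e.symm, ?_, ?_⟩ <;>
  · ext i j
    simp [LinearMap.toMatrix_apply]

lemma Represents.of_submatrix {m' n' : Type*} [Fintype m'] [DecidableEq m'] [Fintype n']
    [DecidableEq n'] (e : m' ≃ m) (f : n' ≃ n)
    (h : Represents A B (M.submatrix e f) (N.submatrix f e)) : Represents A B M N := by
  have := h.submatrix e.symm f.symm
  simpa using this

/-- Direct sums of pairs are represented by block diagonal matrices. -/
lemma Represents.fromBlocks {m' n' : Type*} [Fintype m'] [DecidableEq m'] [Fintype n']
    [DecidableEq n'] {M' : Matrix m' n' F} {N' : Matrix n' m' F}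
    {V₁ V₂ : Submodule F V} {W₁ W₂ : Submodule F W} (hV : IsCompl V₁ V₂) (hW : IsCompl W₁ W₂)
    {hA₁ : ∀ x ∈ V₁, A x ∈ W₁} {hB₁ : ∀ x ∈ W₁, B x ∈ V₁}
    {hA₂ : ∀ x ∈ V₂, A x ∈ W₂} {hB₂ : ∀ x ∈ W₂, B x ∈ V₂}
    (h₁ : Represents (A.restrict hA₁) (B.restrict hB₁) M N)
    (h₂ : Represents (A.restrict hA₂) (B.restrict hB₂) M' N') :
    Represents A B (fromBlocks M 0 0 M') (fromBlocks N 0 0 N') := by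
  obtain ⟨bV, bW, h₁, h₁'⟩ := h₁
  obtain ⟨bV', bW', h₂, h₂'⟩ := h₂
  rw [toMatrix_eq_iff] at h₁ h₁' h₂ h₂'
  refine ⟨(bV.prod bV').map (Submodule.prodEquivOfIsCompl V₁ V₂ hV),
    (bW.prod bW').map (Submodule.prodEquivOfIsCompl W₁ W₂ hW), ?_, ?_⟩
  · rw [toMatrix_eq_iff]
    rintro (j | j)
    · simpa using congrArg (Submodule.subtype W₁) (h₁ j)
    · simpa using congrArg (Submodule.subtype W₂) (h₂ j)
  · rw [toMatrix_eq_iff]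
    rintro (j | j)
    · simpa using congrArg (Submodule.subtype V₁) (h₁' j)
    · simpa using congrArg (Submodule.subtype V₂) (h₂' j)

lemma Represents.swap (h : Represents A B M N) : Represents B A N M := by
  obtain ⟨bV, bW, h, h'⟩ := h
  exact ⟨bW, bV, h', h⟩

/-- Pairs of maps that are represented by the same matrices are isomorphic. -/
lemma Represents.exists_equiv {V' W' : Type*} [AddCommGroup V'] [Module F V']
    [AddCommGroup W'] [Module F W'] {A' : V' →ₗ[F] W'} {B' : W' →ₗ[F] V'}
    (h : Represents A B M N) (h' : Represents A' B' M N) :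
    ∃ (S : W' ≃ₗ[F] W) (T : V' ≃ₗ[F] V), A ∘ₗ T.toLinearMap = S.toLinearMap ∘ₗ A' ∧
      B ∘ₗ S.toLinearMap = T.toLinearMap ∘ₗ B' := by
  obtain ⟨bV, bW, h₁, h₂⟩ := h
  obtain ⟨bV', bW', h₁', h₂'⟩ := h'
  rw [toMatrix_eq_iff] at h₁ h₂ h₁' h₂'
  refine ⟨bW'.equiv bW (Equiv.refl _), bV'.equiv bV (Equiv.refl _), bV'.ext fun j => ?_,
    bW'.ext fun j => ?_⟩
  · simp [h₁, h₁']
  · simp [h₂, h₂']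

lemma Represents.rank_word (h : Represents A B M N) (k : ℕ) :
    (M * (N * M) ^ k).rank = Module.finrank F (LinearMap.range (A ∘ₗ (B ∘ₗ A) ^ k)) := by
  obtain ⟨bV, bW, rfl, rfl⟩ := h
  rw [← LinearMap.toMatrix_comp, LinearMap.toMatrix_pow, ← LinearMap.toMatrix_comp,
    rank_eq_finrank_range_toLin _ bW bV, toLin_toMatrix]

lemma rank_aeval_toMatrix (b : Module.Basis m F W) (T : W →ₗ[F] W) (p : F[X]) :
    (aeval (LinearMap.toMatrix b b T) p).rank =
      Module.finrank F (LinearMap.range (aeval T p)) := by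
  have : aeval (LinearMap.toMatrix b b T) p = LinearMap.toMatrix b b (aeval T p) :=
    aeval_algHom_apply (LinearMap.toMatrixAlgEquiv b) T p
  rw [this, rank_eq_finrank_range_toLin _ b b, toLin_toMatrix]

lemma Represents.rank_aeval (h : Represents A B M N) (p : F[X]) :
    (aeval (M * N) p).rank = Module.finrank F (LinearMap.range (aeval (A ∘ₗ B) p)) := by
  obtain ⟨bV, bW, rfl, rfl⟩ := h
  rw [← LinearMap.toMatrix_comp, rank_aeval_toMatrix]

lemma Represents.rank_pow (h : Represents A B M N) (k : ℕ) :
    ((M * N) ^ k).rank = Module.finrank F (LinearMap.range ((A ∘ₗ B) ^ k)) := by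
  have := h.rank_aeval (X ^ k)
  rwa [aeval_X_pow, aeval_X_pow] at this

lemma Represents.card_rows [FiniteDimensional F W] (h : Represents A B M N) :
    Fintype.card m = Module.finrank F W := by
  obtain ⟨bV, bW, -⟩ := h
  exact (Module.finrank_eq_card_basis bW).symm

end Represents

section Canonical

variable {F : Type*} [Field F] {V W : Type*} [AddCommGroup V] [Module F V] [AddCommGroup W]
  [Module F W] {A : V →ₗ[F] W} {B : W →ₗ[F] V}

/-- The order of the Jordan blocks and of the pairs of blocks may be changed. -/
lemma HasRepresentation.perm {L L' : List (JordanBlock F)} {P P' : List PairBlock} {r c : ℕ}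
    (h : HasRepresentation A B L P r c) (hL : L.Perm L') (hP : P.Perm P') :
    HasRepresentation A B L' P' r c := by
  obtain ⟨σ, hσ⟩ := exists_equiv_of_perm hL.symm
  obtain ⟨τ, hτ⟩ := exists_equiv_of_perm hP.symm
  have h' : Represents A B (canonA L P r c) (canonB L P r c) := h
  have := h'.submatrix
    (Equiv.sumCongr (sigmaReindex σ hσ JordanBlock.Idx)
      (Equiv.sumCongr (sigmaReindex τ hτ fun b => Fin b.rows) (Equiv.refl (Fin r))))
    (Equiv.sumCongr (sigmaReindex σ hσ JordanBlock.Idx)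
      (Equiv.sumCongr (sigmaReindex τ hτ fun b => Fin b.cols) (Equiv.refl (Fin c))))
  have hA := blockDiagonal'_submatrix_sigmaReindex τ hτ fun b => b.matA F
  have hB := blockDiagonal'_submatrix_sigmaReindex τ hτ fun b => b.matB F
  have hJ := blockDiagonal'_submatrix_sigmaReindex σ hσ JordanBlock.mat
  refine Eq.mp ?_ this
  change _ = Represents A B (canonA L' P' r c) (canonB L' P' r c)
  congr 1
  · rw [canonA, canonA, ← hA]
    ext (i | i | i) (j | j | j) <;> simp [one_apply]
  · rw [canonB, canonB, ← hB, jordanMat, jordanMat, ← hJ]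
    ext (i | i | i) (j | j | j) <;> simp

end Canonical

/-! ### Splitting a chain off a nilpotent pair -/

section Chain

variable {F : Type*} [Field F] {V W : Type*} [AddCommGroup V] [Module F V] [AddCommGroup W]
  [Module F W]

/-- If the Gram matrix of `n` vectors and `n` functionals is a Hankel matrix, with ones on the
antidiagonal and zeros below it, then the vectors are a basis of a complement of the common kernel
of the functionals. -/
lemma isCompl_of_hankel {n : ℕ} (x : Fin n → V) (χ : Fin n → V →ₗ[F] F) (g : ℕ → F)
    (hg : ∀ i j, χ i (x j) = g (i + j)) (g1 : ∀ s, s + 1 = n → g s = 1)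
    (g0 : ∀ s, n ≤ s → g s = 0) :
    LinearIndependent F x ∧
      IsCompl (Submodule.span F (Set.range x)) (⨅ i, LinearMap.ker (χ i)) := by
  let G : (Fin n → F) →ₗ[F] (Fin n → F) :=
    LinearMap.pi fun i => χ i ∘ₗ Fintype.linearCombination F x
  have hG (c : Fin n → F) (i : Fin n) : G c i = ∑ j, c j * g (i + j) := by
    simp [G, Fintype.linearCombination_apply, hg]
  have hinj : Function.Injective G := by
    rw [injective_iff_map_eq_zero]
    intro c hc
    -- the coefficients vanish one after another, by the rows of the Gram matrix from below
    have key (k : ℕ) (hk : k < n) : c ⟨k, hk⟩ = 0 := by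
      induction k using Nat.strong_induction_on with
      | _ k ih =>
        have h := hG c ⟨n - 1 - k, by omega⟩
        rw [hc, Finset.sum_eq_single ⟨k, hk⟩] at h
        · have h1 : n - 1 - k + k = n - 1 := by omega
          simp only [h1, g1 (n - 1) (by omega), mul_one] at h
          exact h.symm
        · intro j _ hj
          rcases lt_trichotomy (j : ℕ) k with hlt | heq | hgt
          · rw [ih j hlt j.2, zero_mul]
          · exact absurd (Fin.ext heq) hj
          · rw [g0 _ (by simp only; omega), mul_zero]
        · simp
    ext k
    exact key k k.2
  have hsurj : Function.Surjective G := LinearMap.surjective_of_injective hinj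
  refine ⟨?_, ?_, ?_⟩
  · rw [Fintype.linearIndependent_iff]
    intro c hc
    have : c = 0 := hinj (by
      ext i
      simp only [G, LinearMap.pi_apply, LinearMap.comp_apply, Fintype.linearCombination_apply, hc,
        map_zero])
    simp [this]
  · rw [Submodule.disjoint_def]
    intro v hv hv'
    rw [← Fintype.range_linearCombination] at hv
    obtain ⟨c, rfl⟩ := hv
    have : c = 0 := hinj (by
      ext i
      have := (Submodule.mem_iInf _).1 hv' i
      simpa [G] using this)
    simp [this]
  · rw [codisjoint_iff, eq_top_iff]
    intro v _
    obtain ⟨c, hc⟩ := hsurj fun i => χ i v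
    rw [Submodule.mem_sup]
    refine ⟨Fintype.linearCombination F x c, ?_, v - Fintype.linearCombination F x c, ?_, by abel⟩
    · rw [← Fintype.range_linearCombination]
      exact ⟨c, rfl⟩
    · rw [Submodule.mem_iInf]
      intro i
      have := congrFun hc i
      simp only [G, LinearMap.pi_apply, LinearMap.comp_apply] at this
      rw [LinearMap.mem_ker, map_sub, this, sub_self]

/-- The pair `(A, B)` is the direct sum of a pair with the matrices of a chain, whose
basis vectors are `m` vectors of `W` and `n` vectors of `V`, and of another pair. The chain starts
in `V` if `s = 0`, `t = 1` and in `W` if `s = 1`, `t = 0`. -/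
def Splits (A : V →ₗ[F] W) (B : W →ₗ[F] V) (m n s t : ℕ) : Prop :=
  ∃ (V₁ V₂ : Submodule F V) (W₁ W₂ : Submodule F W) (_ : IsCompl V₁ V₂) (_ : IsCompl W₁ W₂)
    (hA₁ : ∀ x ∈ V₁, A x ∈ W₁) (hB₁ : ∀ x ∈ W₁, B x ∈ V₁)
    (_ : ∀ x ∈ V₂, A x ∈ W₂) (_ : ∀ x ∈ W₂, B x ∈ V₂),
    Represents (A.restrict hA₁) (B.restrict hB₁) (shiftMat F m n s) (shiftMat F n m t)

lemma Splits.swap {A : V →ₗ[F] W} {B : W →ₗ[F] V} {m n s t : ℕ} (h : Splits A B m n s t) :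
    Splits B A n m t s := by
  obtain ⟨V₁, V₂, W₁, W₂, hV, hW, hA₁, hB₁, hA₂, hB₂, h⟩ := h
  exact ⟨W₁, W₂, V₁, V₂, hW, hV, hB₁, hA₁, hB₂, hA₂, h.swap⟩

lemma sum_shiftMat_smul {U : Type*} [AddCommGroup U] [Module F U] (p q s : ℕ) (z : ℕ → U)
    (j : Fin q) :
    ∑ i : Fin p, shiftMat F p q s i j • z i = if (j : ℕ) + s < p then z (j + s) else 0 := by
  split_ifs with hj
  · rw [Finset.sum_eq_single ⟨j + s, hj⟩]
    · simp [shiftMat]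
    · intro i _ hi
      have : ¬ (i : ℕ) = j + s := fun h => hi (Fin.ext h)
      simp [shiftMat, this]
    · simp
  · refine Finset.sum_eq_zero fun i _ => ?_
    have : ¬ (i : ℕ) = j + s := by have := i.2; omega
    simp [shiftMat, this]

/-- Vectors that `A` and `B` map along a chain span a direct summand of the pair if there are
functionals with Hankel Gram matrices whose common kernels are mapped to each other. -/
lemma splits_of_hankel {A : V →ₗ[F] W} {B : W →ₗ[F] V} {m n s t : ℕ} (x : ℕ → V) (y : ℕ → W)
    (χ : ℕ → V →ₗ[F] F) (ψ : ℕ → W →ₗ[F] F) (g h : ℕ → F)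
    (hg : ∀ i j, χ i (x j) = g (i + j)) (g1 : ∀ s, s + 1 = n → g s = 1)
    (g0 : ∀ s, n ≤ s → g s = 0)
    (hh : ∀ i j, ψ i (y j) = h (i + j)) (h1 : ∀ s, s + 1 = m → h s = 1)
    (h0 : ∀ s, m ≤ s → h s = 0)
    (hA : ∀ v, (∀ i < n, χ i v = 0) → ∀ i < m, ψ i (A v) = 0)
    (hB : ∀ w, (∀ i < m, ψ i w = 0) → ∀ i < n, χ i (B w) = 0)
    (hx : ∀ j < n, A (x j) = if j + s < m then y (j + s) else 0)
    (hy : ∀ j < m, B (y j) = if j + t < n then x (j + t) else 0) :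
    Splits A B m n s t := by
  obtain ⟨hlx, hcx⟩ := isCompl_of_hankel (fun i : Fin n => x i) (fun i : Fin n => χ i) g
    (fun i j => hg i j) g1 g0
  obtain ⟨hly, hcy⟩ := isCompl_of_hankel (fun i : Fin m => y i) (fun i : Fin m => ψ i) h
    (fun i j => hh i j) h1 h0
  have hAx (j : Fin n) : A (x j) = ∑ i : Fin m, shiftMat F m n s i j • y i := by
    rw [hx j j.2, sum_shiftMat_smul m n s y j]
  have hBy (j : Fin m) : B (y j) = ∑ i : Fin n, shiftMat F n m t i j • x i := by
    rw [hy j j.2, sum_shiftMat_smul n m t x j]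
  refine ⟨_, _, _, _, hcx, hcy, ?_, ?_, ?_, ?_, Module.Basis.span hlx, Module.Basis.span hly,
    ?_, ?_⟩
  · intro v hv
    have : Submodule.span F (Set.range fun i : Fin n => x i) ≤
        (Submodule.span F (Set.range fun i : Fin m => y i)).comap A := by
      rw [Submodule.span_le]
      rintro _ ⟨j, rfl⟩
      change A (x j) ∈ Submodule.span F (Set.range fun i : Fin m => y i)
      rw [hAx]
      exact sum_mem fun i _ => Submodule.smul_mem _ _ (Submodule.subset_span ⟨i, rfl⟩)
    exact this hv
  · intro v hv
    have : Submodule.span F (Set.range fun i : Fin m => y i) ≤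
        (Submodule.span F (Set.range fun i : Fin n => x i)).comap B := by
      rw [Submodule.span_le]
      rintro _ ⟨j, rfl⟩
      change B (y j) ∈ Submodule.span F (Set.range fun i : Fin n => x i)
      rw [hBy]
      exact sum_mem fun i _ => Submodule.smul_mem _ _ (Submodule.subset_span ⟨i, rfl⟩)
    exact this hv
  · intro v hv
    rw [Submodule.mem_iInf] at hv ⊢
    exact fun i => hA v (fun i hi => hv ⟨i, hi⟩) i i.2
  · intro v hv
    rw [Submodule.mem_iInf] at hv ⊢
    exact fun i => hB v (fun i hi => hv ⟨i, hi⟩) i i.2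
  · rw [toMatrix_eq_iff]
    intro j
    apply Subtype.ext
    simp [Module.Basis.span_apply, hAx]
  · rw [toMatrix_eq_iff]
    intro j
    apply Subtype.ext
    simp [Module.Basis.span_apply, hBy]

lemma exists_functional {U : Type*} [AddCommGroup U] [Module F U] {u : U} (hu : u ≠ 0) :
    ∃ φ : U →ₗ[F] F, φ u = 1 := by
  obtain ⟨φ, hφ⟩ := not_forall.1 (mt (Module.forall_dual_apply_eq_zero_iff F u).1 hu)
  exact ⟨(φ u)⁻¹ • φ, inv_mul_cancel₀ hφ⟩

variable {A : V →ₗ[F] W} {B : W →ₗ[F] V}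

lemma apply_comp_pow (A : V →ₗ[F] W) (B : W →ₗ[F] V) (k : ℕ) (v : V) :
    ((A ∘ₗ B) ^ k) (A v) = A (((B ∘ₗ A) ^ k) v) := by
  induction k generalizing v with
  | zero => rfl
  | succ k ih =>
    rw [pow_succ, pow_succ, Module.End.mul_apply, Module.End.mul_apply, ← ih]
    rfl

lemma comp_pow_succ_apply (A : V →ₗ[F] W) (B : W →ₗ[F] V) (k : ℕ) (v : V) :
    ((B ∘ₗ A) ^ (k + 1)) v = B (A (((B ∘ₗ A) ^ k) v)) := by
  rw [pow_succ', Module.End.mul_apply]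
  rfl

/-- A longest chain, which starts in `V` and ends in `W`, splits off. -/
lemma splits_of_even_chain {k : ℕ} {v : V} (hv : A (((B ∘ₗ A) ^ k) v) ≠ 0)
    (hV : (B ∘ₗ A) ^ (k + 1) = 0) (hW : (A ∘ₗ B) ^ (k + 1) = 0) :
    Splits A B (k + 1) (k + 1) 0 1 := by
  obtain ⟨φ, hφ⟩ := exists_functional (F := F) hv
  have hV0 (s : ℕ) (hs : k + 1 ≤ s) (v : V) : ((B ∘ₗ A) ^ s) v = 0 := by
    rw [pow_eq_zero_of_le hs hV, LinearMap.zero_apply]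
  have hadd (i j : ℕ) : ((B ∘ₗ A) ^ i) (((B ∘ₗ A) ^ j) v) = ((B ∘ₗ A) ^ (i + j)) v := by
    rw [pow_add, Module.End.mul_apply]
  have hg1 (s : ℕ) (hs : s + 1 = k + 1) : φ (A (((B ∘ₗ A) ^ s) v)) = 1 := by
    rw [Nat.succ_injective hs, hφ]
  have hg0 (s : ℕ) (hs : k + 1 ≤ s) : φ (A (((B ∘ₗ A) ^ s) v)) = 0 := by
    rw [hV0 s hs, map_zero, map_zero]
  refine splits_of_hankel (fun j => ((B ∘ₗ A) ^ j) v) (fun j => A (((B ∘ₗ A) ^ j) v))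
    (fun i => φ ∘ₗ A ∘ₗ (B ∘ₗ A) ^ i) (fun i => φ ∘ₗ (A ∘ₗ B) ^ i)
    (fun s => φ (A (((B ∘ₗ A) ^ s) v))) (fun s => φ (A (((B ∘ₗ A) ^ s) v)))
    (fun i j => ?_) hg1 hg0 (fun i j => ?_) hg1 hg0 (fun v hv i hi => ?_) (fun w hw i hi => ?_)
    (fun j hj => ?_) (fun j hj => ?_)
  · simp only [LinearMap.comp_apply, hadd]
  · simp only [LinearMap.comp_apply, apply_comp_pow, hadd]
  · rw [LinearMap.comp_apply, apply_comp_pow]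
    exact hv i hi
  · rw [LinearMap.comp_apply, LinearMap.comp_apply, apply_comp_pow, ← comp_pow_succ_apply]
    rcases (Nat.succ_le_of_lt hi).eq_or_lt with h | h
    · rw [show i + 1 = k + 1 from h, hW, LinearMap.zero_apply, map_zero]
    · exact hw (i + 1) h
  · rw [if_pos (by omega), add_zero]
  · rw [← comp_pow_succ_apply]
    split_ifs with h
    · rfl
    · exact hV0 _ (not_lt.1 h) v

/-- A longest chain, which starts and ends in `V`, splits off. -/
lemma splits_of_odd_chain {k : ℕ} {v : V} (hv : ((B ∘ₗ A) ^ k) v ≠ 0)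
    (hV : ∀ v, A (((B ∘ₗ A) ^ k) v) = 0) (hW : ∀ w, B (((A ∘ₗ B) ^ k) w) = 0) :
    Splits A B k (k + 1) 0 1 := by
  obtain ⟨φ, hφ⟩ := exists_functional (F := F) hv
  have hV1 : (B ∘ₗ A) ^ (k + 1) = 0 := by
    ext v
    rw [comp_pow_succ_apply, hV, map_zero, LinearMap.zero_apply]
  have hadd (i j : ℕ) : ((B ∘ₗ A) ^ i) (((B ∘ₗ A) ^ j) v) = ((B ∘ₗ A) ^ (i + j)) v := by
    rw [pow_add, Module.End.mul_apply]
  have hg1 (s : ℕ) (hs : s + 1 = k + 1) : φ (((B ∘ₗ A) ^ s) v) = 1 := by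
    rw [Nat.succ_injective hs, hφ]
  have hg0 (s : ℕ) (hs : k + 1 ≤ s) : φ (((B ∘ₗ A) ^ s) v) = 0 := by
    rw [pow_eq_zero_of_le hs hV1, LinearMap.zero_apply, map_zero]
  refine splits_of_hankel (fun j => ((B ∘ₗ A) ^ j) v) (fun j => A (((B ∘ₗ A) ^ j) v))
    (fun i => φ ∘ₗ (B ∘ₗ A) ^ i) (fun i => φ ∘ₗ B ∘ₗ (A ∘ₗ B) ^ i)
    (fun s => φ (((B ∘ₗ A) ^ s) v)) (fun s => φ (((B ∘ₗ A) ^ (s + 1)) v))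
    (fun i j => ?_) hg1 hg0 (fun i j => ?_) (fun s hs => hg1 (s + 1) (by omega))
    (fun s hs => hg0 (s + 1) (by omega)) (fun v hv i hi => ?_) (fun w hw i hi => ?_)
    (fun j hj => ?_) (fun j hj => ?_)
  · simp only [LinearMap.comp_apply, hadd]
  · simp only [LinearMap.comp_apply, apply_comp_pow, hadd, comp_pow_succ_apply]
  · rw [LinearMap.comp_apply, LinearMap.comp_apply, apply_comp_pow, ← comp_pow_succ_apply]
    exact hv (i + 1) (by omega)
  · rw [LinearMap.comp_apply, apply_comp_pow]
    rcases (Nat.le_of_lt_succ hi).eq_or_lt with rfl | h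
    · rw [hW, map_zero]
    · exact hw i h
  · split_ifs with h
    · rfl
    · rw [show j = k by omega]
      exact hV v
  · rw [← comp_pow_succ_apply, if_pos (by omega)]

/-- A nilpotent pair on nonzero spaces has a direct summand that is a single chain. -/
lemma exists_splits (hAB : IsNilpotent (A ∘ₗ B)) (h : Nontrivial V ∨ Nontrivial W) :
    ∃ m n, 0 < m + n ∧ ((n = m ∨ n = m + 1) ∧ Splits A B m n 0 1 ∨
      (m = n ∨ m = n + 1) ∧ Splits A B m n 1 0) := by
  classical
  have hex : ∃ k, (B ∘ₗ A) ^ k = 0 ∧ (A ∘ₗ B) ^ k = 0 := by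
    obtain ⟨N, hN⟩ := hAB
    refine ⟨N + 1, ?_, by rw [pow_succ, hN, zero_mul]⟩
    ext v
    rw [comp_pow_succ_apply, ← apply_comp_pow, hN]
    simp
  obtain ⟨hV, hW⟩ := Nat.find_spec hex
  rcases hk : Nat.find hex with _ | k
  · rw [hk, pow_zero] at hV hW
    rcases h with h | h
    · exact absurd hV one_ne_zero
    · exact absurd hW one_ne_zero
  rw [hk] at hV hW
  have hmin : (B ∘ₗ A) ^ k = 0 → (A ∘ₗ B) ^ k ≠ 0 := fun h h' =>
    Nat.find_min hex (show k < Nat.find hex by omega) ⟨h, h'⟩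
  by_cases h1 : ∀ v, A (((B ∘ₗ A) ^ k) v) = 0
  · by_cases h2 : ∀ w, B (((A ∘ₗ B) ^ k) w) = 0
    · by_cases h3 : (B ∘ₗ A) ^ k = 0
      · obtain ⟨w, hw⟩ := not_forall.1 (mt LinearMap.ext (hmin h3))
        exact ⟨k + 1, k, by omega, Or.inr ⟨Or.inr rfl, (splits_of_odd_chain hw h2 h1).swap⟩⟩
      · obtain ⟨v, hv⟩ := not_forall.1 (mt LinearMap.ext h3)
        exact ⟨k, k + 1, by omega, Or.inl ⟨Or.inr rfl, splits_of_odd_chain hv h1 h2⟩⟩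
    · obtain ⟨w, hw⟩ := not_forall.1 h2
      exact ⟨k + 1, k + 1, by omega, Or.inr ⟨Or.inl rfl, (splits_of_even_chain hw hW hV).swap⟩⟩
  · obtain ⟨v, hv⟩ := not_forall.1 h1
    exact ⟨k + 1, k + 1, by omega, Or.inl ⟨Or.inl rfl, splits_of_even_chain hv hV hW⟩⟩

end Chain

/-! ### The canonical form of a nilpotent pair -/

section Nilpotent

variable {F : Type*} [Field F]

/-- The summand `diag(A_1, …, A_p, 0)` of the canonical form. -/
def nilA (F : Type*) [Field F] (P : List PairBlock) (r c : ℕ) :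
    Matrix (((i : Fin P.length) × Fin (P.get i).rows) ⊕ Fin r)
      (((i : Fin P.length) × Fin (P.get i).cols) ⊕ Fin c) F :=
  fromBlocks (blockDiagonal' fun i => (P.get i).matA F) 0 0 0

/-- The summand `diag(B_1, …, B_p, 0)` of the canonical form. -/
def nilB (F : Type*) [Field F] (P : List PairBlock) (r c : ℕ) :
    Matrix (((i : Fin P.length) × Fin (P.get i).cols) ⊕ Fin c)
      (((i : Fin P.length) × Fin (P.get i).rows) ⊕ Fin r) F :=
  fromBlocks (blockDiagonal' fun i => (P.get i).matB F) 0 0 0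

/-- The index type of a direct sum over a list `a :: l`. -/
noncomputable def sigmaCons {α : Type*} (R : α → Type*) (a : α) (l : List α) :
    R a ⊕ (Σ i : Fin l.length, R (l.get i)) ≃ Σ i : Fin (a :: l).length, R ((a :: l).get i) :=
  Equiv.ofBijective
    (Sum.elim (fun x => ⟨(0 : Fin (l.length + 1)), x⟩) (fun x => ⟨Fin.succ x.1, x.2⟩)) <| by
    constructor
    · rintro (x | ⟨i, x⟩) (y | ⟨j, y⟩) h
      · exact congrArg Sum.inl (eq_of_heq (Sigma.mk.inj_iff.1 h).2)
      · exact absurd (congrArg (fun z => z.1) h) (Fin.succ_ne_zero j).symm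
      · exact absurd (congrArg (fun z => z.1) h) (Fin.succ_ne_zero i)
      · obtain ⟨h1, h2⟩ := Sigma.mk.inj_iff.1 h
        obtain rfl := Fin.succ_injective _ h1
        have h3 : x = y := eq_of_heq h2
        subst h3
        rfl
    · rintro ⟨i, x⟩
      revert x
      refine Fin.cases (fun x => ⟨Sum.inl x, rfl⟩) (fun i x => ⟨Sum.inr ⟨i, x⟩, rfl⟩) i

lemma blockDiagonal'_submatrix_sigmaCons {α : Type*} {R C : α → Type*}
    (M : ∀ a, Matrix (R a) (C a) F) (a : α) (l : List α) :
    (blockDiagonal' fun i => M ((a :: l).get i)).submatrix (sigmaCons R a l) (sigmaCons C a l) =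
      fromBlocks (M a) 0 0 (blockDiagonal' fun i => M (l.get i)) := by
  ext (x | ⟨i, x⟩) (y | ⟨j, y⟩)
  · exact blockDiagonal'_apply_eq (fun i => M ((a :: l).get i)) (0 : Fin (l.length + 1)) x y
  · exact blockDiagonal'_apply_ne (fun i => M ((a :: l).get i)) (k := (0 : Fin (l.length + 1)))
      (k' := j.succ) x y (Fin.succ_ne_zero j).symm
  · exact blockDiagonal'_apply_ne (fun i => M ((a :: l).get i)) (k := i.succ)
      (k' := (0 : Fin (l.length + 1))) x y (Fin.succ_ne_zero i)
  · by_cases h : i = j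
    · subst h
      rw [fromBlocks_apply₂₂, blockDiagonal'_apply_eq]
      exact blockDiagonal'_apply_eq (fun i => M ((a :: l).get i)) i.succ x y
    · rw [fromBlocks_apply₂₂, blockDiagonal'_apply_ne _ _ _ h]
      exact blockDiagonal'_apply_ne (fun i => M ((a :: l).get i)) (k := i.succ) (k' := j.succ) x y
        fun h' => h (Fin.succ_injective _ h')

variable {V W : Type*} [AddCommGroup V] [Module F V] [AddCommGroup W] [Module F W]
  {A : V →ₗ[F] W} {B : W →ₗ[F] V}

lemma Represents.nil_cons {P : List PairBlock} {r c : ℕ} (b : PairBlock)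
    (h : Represents A B (Matrix.fromBlocks (b.matA F) 0 0 (nilA F P r c))
      (Matrix.fromBlocks (b.matB F) 0 0 (nilB F P r c))) :
    Represents A B (nilA F (b :: P) r c) (nilB F (b :: P) r c) := by
  refine Represents.of_submatrix
    ((Equiv.sumAssoc _ _ _).symm.trans
      (Equiv.sumCongr (sigmaCons (fun b => Fin b.rows) b P) (Equiv.refl _)))
    ((Equiv.sumAssoc _ _ _).symm.trans
      (Equiv.sumCongr (sigmaCons (fun b => Fin b.cols) b P) (Equiv.refl _))) ?_
  have hA := blockDiagonal'_submatrix_sigmaCons (fun b => b.matA F) b P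
  have hB := blockDiagonal'_submatrix_sigmaCons (fun b => b.matB F) b P
  convert h using 1
  · ext (i | i | i) (j | j | j)
    · exact congrFun₂ hA (Sum.inl i) (Sum.inl j)
    · exact congrFun₂ hA (Sum.inl i) (Sum.inr j)
    · rfl
    · exact congrFun₂ hA (Sum.inr i) (Sum.inl j)
    · exact congrFun₂ hA (Sum.inr i) (Sum.inr j)
    all_goals rfl
  · ext (i | i | i) (j | j | j)
    · exact congrFun₂ hB (Sum.inl i) (Sum.inl j)
    · exact congrFun₂ hB (Sum.inl i) (Sum.inr j)
    · rfl
    · exact congrFun₂ hB (Sum.inr i) (Sum.inl j)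
    · exact congrFun₂ hB (Sum.inr i) (Sum.inr j)
    all_goals rfl

/-- Zero summands are collected in the last block. -/
lemma Represents.nil_zero {P : List PairBlock} {r c r' c' : ℕ}
    (h : Represents A B (Matrix.fromBlocks (0 : Matrix (Fin r') (Fin c') F) 0 0 (nilA F P r c))
      (Matrix.fromBlocks (0 : Matrix (Fin c') (Fin r') F) 0 0 (nilB F P r c))) :
    Represents A B (nilA F P (r' + r) (c' + c)) (nilB F P (r' + r) (c' + c)) := by
  refine Represents.of_submatrix
    (((Equiv.sumAssoc _ _ _).symm.trans (Equiv.sumCongr (Equiv.sumComm _ _) (Equiv.refl _))).trans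
      ((Equiv.sumAssoc _ _ _).trans (Equiv.sumCongr (Equiv.refl _) finSumFinEquiv)))
    (((Equiv.sumAssoc _ _ _).symm.trans (Equiv.sumCongr (Equiv.sumComm _ _) (Equiv.refl _))).trans
      ((Equiv.sumAssoc _ _ _).trans (Equiv.sumCongr (Equiv.refl _) finSumFinEquiv))) ?_
  convert h using 1
  · ext (i | i | i) (j | j | j) <;> rfl
  · ext (i | i | i) (j | j | j) <;> rfl

lemma isNilpotent_comp_restrict {V₂ : Submodule F V} {W₂ : Submodule F W}
    (hA : ∀ x ∈ V₂, A x ∈ W₂) (hB : ∀ x ∈ W₂, B x ∈ V₂)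
    (h : ∃ N, ∀ w ∈ W₂, ((A ∘ₗ B) ^ N) w = 0) :
    IsNilpotent (A.restrict hA ∘ₗ B.restrict hB) := by
  obtain ⟨N, hN⟩ := h
  have key (k : ℕ) (w : W₂) :
      (((A.restrict hA ∘ₗ B.restrict hB) ^ k) w : W) = ((A ∘ₗ B) ^ k) w := by
    induction k with
    | zero => rfl
    | succ k ih =>
      rw [pow_succ', pow_succ', Module.End.mul_apply, Module.End.mul_apply, ← ih]
      rfl
  refine ⟨N, ?_⟩
  ext w
  rw [key, hN w w.2]
  rfl

end Nilpotent

universe u v w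

/-- A nilpotent pair is a direct sum of chains. -/
lemma exists_represents_nil {F : Type w} [Field F] (d : ℕ) :
    ∀ {V : Type u} {W : Type v} [AddCommGroup V] [Module F V] [FiniteDimensional F V]
      [AddCommGroup W] [Module F W] [FiniteDimensional F W] (A : V →ₗ[F] W) (B : W →ₗ[F] V),
      Module.finrank F V + Module.finrank F W = d → IsNilpotent (A ∘ₗ B) →
      ∃ (P : List PairBlock) (r c : ℕ), Represents A B (nilA F P r c) (nilB F P r c) := by
  induction d using Nat.strong_induction_on with
  | _ d ih =>
  intro V W _ _ _ _ _ _ A B hd hAB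
  by_cases hne : Nontrivial V ∨ Nontrivial W
  · obtain ⟨m, n, hmn, hsplit⟩ := exists_splits hAB hne
    have rest {s t : ℕ} (h : Splits A B m n s t) : ∃ (P : List PairBlock) (r c : ℕ),
        Represents A B (fromBlocks (shiftMat F m n s) 0 0 (nilA F P r c))
          (fromBlocks (shiftMat F n m t) 0 0 (nilB F P r c)) := by
      obtain ⟨V₁, V₂, W₁, W₂, hV, hW, hA₁, hB₁, hA₂, hB₂, h⟩ := h
      have hm : m = Module.finrank F W₁ := by simpa using h.card_rows
      have hn : n = Module.finrank F V₁ := by simpa using h.swap.card_rows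
      have := Submodule.finrank_add_eq_of_isCompl hV
      have := Submodule.finrank_add_eq_of_isCompl hW
      obtain ⟨P, r, c, h'⟩ := ih _ (by omega) (A.restrict hA₂) (B.restrict hB₂) rfl
        (isNilpotent_comp_restrict hA₂ hB₂ (by
          obtain ⟨N, hN⟩ := hAB
          exact ⟨N, fun w _ => by rw [hN, LinearMap.zero_apply]⟩))
      exact ⟨P, r, c, h.fromBlocks hV hW h'⟩
    -- a chain of length one contributes to the zero blocks, a longer one is a pair of blocks
    rcases hsplit with ⟨rfl | rfl, h⟩ | ⟨rfl | rfl, h⟩ <;> obtain ⟨P, r, c, h⟩ := rest h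
    · exact ⟨⟨.idShift, n, by omega⟩ :: P, r, c, h.nil_cons ⟨.idShift, n, by omega⟩⟩
    · rcases Nat.eq_zero_or_pos m with rfl | hm
      · refine ⟨P, 0 + r, 0 + 1 + c, Represents.nil_zero ?_⟩
        convert h using 2 <;> exact Subsingleton.elim _ _
      · exact ⟨⟨.wide, m, hm⟩ :: P, r, c, h.nil_cons ⟨.wide, m, hm⟩⟩
    · exact ⟨⟨.shiftId, m, by omega⟩ :: P, r, c, h.nil_cons ⟨.shiftId, m, by omega⟩⟩
    · rcases Nat.eq_zero_or_pos n with rfl | hn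
      · refine ⟨P, 0 + 1 + r, 0 + c, Represents.nil_zero ?_⟩
        convert h using 2 <;> exact Subsingleton.elim _ _
      · exact ⟨⟨.tall, n, hn⟩ :: P, r, c, h.nil_cons ⟨.tall, n, hn⟩⟩
  · rw [not_or, not_nontrivial_iff_subsingleton, not_nontrivial_iff_subsingleton] at hne
    obtain ⟨_, _⟩ := hne
    have hr : IsEmpty (((i : Fin ([] : List PairBlock).length) ×
        Fin (([] : List PairBlock).get i).rows) ⊕ Fin 0) :=
      ⟨by rintro (⟨i, _⟩ | i) <;> exact i.elim0⟩
    have hc : IsEmpty (((i : Fin ([] : List PairBlock).length) ×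
        Fin (([] : List PairBlock).get i).cols) ⊕ Fin 0) :=
      ⟨by rintro (⟨i, _⟩ | i) <;> exact i.elim0⟩
    refine ⟨[], 0, 0, Module.Basis.empty V, Module.Basis.empty W, ?_, ?_⟩
    · ext i
      exact hr.elim i
    · ext i
      exact hc.elim i

/-! ### Existence of the canonical form -/

section Existence

variable {F : Type*} [Field F] {V W : Type*} [AddCommGroup V] [Module F V]
  [AddCommGroup W] [Module F W] (A : V →ₗ[F] W) (B : W →ₗ[F] V)

/-- A pair in which both maps are invertible. The basis of `V` is the preimage of the basis of `W`
under `A`. -/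
lemma exists_represents_of_bijective [FiniteDimensional F W] (hA : Function.Bijective A)
    (hB : Function.Injective B) : ∃ L : List (JordanBlock F), (∀ b ∈ L, b.Nonsingular) ∧
      Represents A B (1 : Matrix (JordanIdx L) (JordanIdx L) F) (jordanMat L) := by
  obtain ⟨L, b, hL⟩ := exists_isJordanForm (A ∘ₗ B)
  have hunit : IsUnit (A ∘ₗ B) :=
    (LinearMap.isUnit_iff_ker_eq_bot _).2 (LinearMap.ker_eq_bot.2 (hA.1.comp hB))
  refine ⟨L, nonsingular_of_isUnit_jordanMat ?_, b.map (LinearEquiv.ofBijective A hA).symm, b,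
    ?_, ?_⟩
  · rw [← hL]
    exact hunit.map (LinearMap.toMatrixAlgEquiv b)
  · rw [toMatrix_eq_iff]
    intro j
    rw [Finset.sum_eq_single j (fun i _ hi => by rw [one_apply_ne hi, zero_smul]) (by simp),
      one_apply_eq, one_smul, Module.Basis.map_apply]
    exact (LinearEquiv.ofBijective A hA).apply_symm_apply (b j)
  · rw [toMatrix_eq_iff] at hL ⊢
    intro j
    apply hA.1
    rw [map_sum]
    refine (hL j).trans (Finset.sum_congr rfl fun i _ => ?_)
    rw [map_smul, Module.Basis.map_apply]
    exact congrArg _ ((LinearEquiv.ofBijective A hA).apply_symm_apply (b i)).symm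

/-- The pair is split by the Fitting decompositions of `BA` and `AB` into an invertible and a
nilpotent pair. -/
lemma exists_hasRepresentation [FiniteDimensional F V] [FiniteDimensional F W] :
    ∃ (L : List (JordanBlock F)) (P : List PairBlock) (r c : ℕ), (∀ b ∈ L, b.Nonsingular) ∧
      HasRepresentation A B L P r c := by
  obtain ⟨N, ⟨hV, hW⟩, hN⟩ := (((B ∘ₗ A).eventually_isCompl_ker_pow_range_pow.and
    (A ∘ₗ B).eventually_isCompl_ker_pow_range_pow).and (Filter.eventually_gt_atTop 0)).exists
  have hA₁ : ∀ x ∈ LinearMap.range ((B ∘ₗ A) ^ N), A x ∈ LinearMap.range ((A ∘ₗ B) ^ N) := by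
    rintro _ ⟨v, rfl⟩
    exact ⟨A v, apply_comp_pow A B N v⟩
  have hB₁ : ∀ x ∈ LinearMap.range ((A ∘ₗ B) ^ N), B x ∈ LinearMap.range ((B ∘ₗ A) ^ N) := by
    rintro _ ⟨v, rfl⟩
    exact ⟨B v, apply_comp_pow B A N v⟩
  have hA₂ : ∀ x ∈ LinearMap.ker ((B ∘ₗ A) ^ N), A x ∈ LinearMap.ker ((A ∘ₗ B) ^ N) := by
    intro v hv
    rw [LinearMap.mem_ker] at hv ⊢
    rw [apply_comp_pow, hv, map_zero]
  have hB₂ : ∀ x ∈ LinearMap.ker ((A ∘ₗ B) ^ N), B x ∈ LinearMap.ker ((B ∘ₗ A) ^ N) := by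
    intro v hv
    rw [LinearMap.mem_ker] at hv ⊢
    rw [apply_comp_pow, hv, map_zero]
  obtain ⟨M, rfl⟩ := Nat.exists_eq_succ_of_ne_zero hN.ne'
  have injA : Function.Injective (A.restrict hA₁) := by
    rw [injective_iff_map_eq_zero]
    rintro ⟨v, hv⟩ h
    have h' : A v = 0 := congrArg Subtype.val h
    refine Subtype.ext (Submodule.disjoint_def.1 hV.disjoint v ?_ hv)
    rw [LinearMap.mem_ker, pow_succ, Module.End.mul_apply, LinearMap.comp_apply, h', map_zero,
      map_zero]
  have injB : Function.Injective (B.restrict hB₁) := by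
    rw [injective_iff_map_eq_zero]
    rintro ⟨v, hv⟩ h
    have h' : B v = 0 := congrArg Subtype.val h
    refine Subtype.ext (Submodule.disjoint_def.1 hW.disjoint v ?_ hv)
    rw [LinearMap.mem_ker, pow_succ, Module.End.mul_apply, LinearMap.comp_apply, h', map_zero,
      map_zero]
  have hdim := le_antisymm (LinearMap.finrank_le_finrank_of_injective injA)
    (LinearMap.finrank_le_finrank_of_injective injB)
  obtain ⟨L, hL, h₁⟩ := exists_represents_of_bijective (A.restrict hA₁) (B.restrict hB₁)
    ⟨injA, (LinearMap.injective_iff_surjective_of_finrank_eq_finrank hdim).1 injA⟩ injB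
  obtain ⟨P, r, c, h₂⟩ := exists_represents_nil _ (A.restrict hA₂) (B.restrict hB₂) rfl
    (isNilpotent_comp_restrict hA₂ hB₂ ⟨M + 1, fun w hw => hw⟩)
  exact ⟨L, P, r, c, hL, h₁.fromBlocks hV.symm hW.symm h₂⟩

end Existence

/-! ### Uniqueness of the canonical form -/

section Uniqueness

variable {F : Type*} [Field F] {V W : Type*} [AddCommGroup V] [Module F V]
  [AddCommGroup W] [Module F W] {A : V →ₗ[F] W} {B : W →ₗ[F] V}

/-- On the nilpotent part of `AB`, a prime `f ≠ x` is invertible. -/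
lemma rank_aeval_canon (L : List (JordanBlock F)) (P : List PairBlock) (r c : ℕ) {f : F[X]}
    (hf : f.Monic) (hf' : Irreducible f) (hX : f ≠ X) : ∃ C, ∀ j,
      (aeval (canonA L P r c * canonB L P r c) (f ^ j)).rank =
        C + (L.map fun b => b.polyRank f j).sum := by
  have hnil : IsNilpotent (fromBlocks
      (blockDiagonal' fun i => ((P.get i).matA F * (P.get i).matB F)) 0 0
      (0 : Matrix (Fin r) (Fin r) F)) := by
    refine ⟨(∑ i, (P.get i).rows) + 1, ?_⟩
    rw [fromBlocks_diagonal_pow, zero_pow (Nat.succ_ne_zero _), ← blockDiagonal'_pow]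
    have : (fun i => (P.get i).matA F * (P.get i).matB F) ^ ((∑ i, (P.get i).rows) + 1) = 0 := by
      ext i x y
      have hle : (P.get i).rows ≤ ∑ i, (P.get i).rows :=
        Finset.single_le_sum (f := fun i => (P.get i).rows) (fun _ _ => Nat.zero_le _)
          (Finset.mem_univ i)
      have : ¬ (x : ℕ) = y + ((∑ i, (P.get i).rows) + 1) := by have := x.2; omega
      rw [Pi.pow_apply, PairBlock.matA_mul_matB_pow]
      simp only [shiftMat, of_apply, if_neg this]
      rfl
    rw [this, blockDiagonal'_zero, fromBlocks_zero]
  have hunit (j : ℕ) := isUnit_aeval_of_isNilpotent (f := f ^ j) (g := X)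
    ((isCoprime_of_monic_irreducible hf hf' monic_X irreducible_X hX).pow_left)
    (x := fromBlocks (blockDiagonal' fun i => ((P.get i).matA F * (P.get i).matB F)) 0 0
      (0 : Matrix (Fin r) (Fin r) F)) (by rwa [aeval_X])
  refine ⟨Fintype.card (((i : Fin P.length) × Fin (P.get i).rows) ⊕ Fin r), fun j => ?_⟩
  rw [canonA_mul_canonB, aeval_fromBlocks_zero, rank_fromBlocks_zero, rank_of_isUnit _ (hunit j),
    rank_aeval_jordanMat L hf hf', add_comm]

/-- The nonsingular part of a Jordan form of `AB` is determined up to the order of the blocks. -/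
lemma HasRepresentation.nonsingularPart_perm {L K : List (JordanBlock F)} {P : List PairBlock}
    {r c : ℕ} (h : HasRepresentation A B L P r c) (hL : ∀ b ∈ L, b.Nonsingular)
    (hK : IsJordanForm K (A ∘ₗ B)) : L.Perm (nonsingularPart K) := by
  refine perm_of_polyRank hL (fun b hb => ?_) fun f hf hf' hX => ?_
  · simpa [nonsingularPart] using (List.mem_filter.1 hb).2
  obtain ⟨C, hC⟩ := rank_aeval_canon L P r c hf hf' hX
  obtain ⟨C', hC'⟩ := polyRank_nonsingularPart K hX
  refine ⟨C, C', fun j => ?_⟩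
  obtain ⟨b, hb⟩ := hK
  have h' : Represents A B (canonA L P r c) (canonB L P r c) := h
  rw [← hC, ← hC', h'.rank_aeval, ← rank_aeval_jordanMat K hf hf', ← hb, rank_aeval_toMatrix]

lemma HasRepresentation.jordan_perm {L L' : List (JordanBlock F)} {P P' : List PairBlock}
    {r r' c c' : ℕ} (h : HasRepresentation A B L P r c) (h' : HasRepresentation A B L' P' r' c')
    (hL : ∀ b ∈ L, b.Nonsingular) (hL' : ∀ b ∈ L', b.Nonsingular) : L.Perm L' := by
  refine perm_of_polyRank hL hL' fun f hf hf' hX => ?_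
  obtain ⟨C, hC⟩ := rank_aeval_canon L P r c hf hf' hX
  obtain ⟨C', hC'⟩ := rank_aeval_canon L' P' r' c' hf hf' hX
  refine ⟨C, C', fun j => ?_⟩
  have h₁ : Represents A B (canonA L P r c) (canonB L P r c) := h
  have h₂ : Represents A B (canonA L' P' r' c') (canonB L' P' r' c') := h'
  rw [← hC, ← hC', h₁.rank_aeval, h₂.rank_aeval]

lemma HasRepresentation.unique {L L' : List (JordanBlock F)} {P P' : List PairBlock}
    {r r' c c' : ℕ} (hL : ∀ b ∈ L, b.Nonsingular) (hL' : ∀ b ∈ L', b.Nonsingular)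
    (h : HasRepresentation A B L P r c) (h' : HasRepresentation A B L' P' r' c') :
    L.Perm L' ∧ P.Perm P' ∧ r = r' ∧ c = c' := by
  have h₁ : Represents A B (canonA L P r c) (canonB L P r c) := h
  have h₂ : Represents A B (canonA L' P' r' c') (canonB L' P' r' c') := h'
  have hJ := isUnit_jordanMat hL
  have hJ' := isUnit_jordanMat hL'
  refine ⟨h.jordan_perm h' hL hL', perm_of_word_ranks
    (n := Fintype.card (JordanIdx L)) (n' := Fintype.card (JordanIdx L'))
    (fun k => ?_) (fun k => ?_) (fun k => ?_)
    (fun k => ?_)⟩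
  · rw [← rank_canonA_word L P r c hJ, ← rank_canonA_word L' P' r' c' hJ', h₁.rank_word,
      h₂.rank_word]
  · rw [← rank_canonB_word L P r c hJ, ← rank_canonB_word L' P' r' c' hJ', h₁.swap.rank_word,
      h₂.swap.rank_word]
  · rw [← rank_canonAB_pow L P r c hJ, ← rank_canonAB_pow L' P' r' c' hJ', h₁.rank_pow,
      h₂.rank_pow]
  · rw [← rank_canonBA_pow L P r c hJ, ← rank_canonBA_pow L' P' r' c' hJ', h₁.swap.rank_pow,
      h₂.swap.rank_pow]

/-- The nonsingular blocks of any Jordan form of `AB` may be prescribed in the canonical form. -/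
lemma exists_hasRepresentation_nonsingularPart [FiniteDimensional F V] [FiniteDimensional F W]
    (A : V →ₗ[F] W) (B : W →ₗ[F] V) {K : List (JordanBlock F)} (hK : IsJordanForm K (A ∘ₗ B)) :
    ∃ (P : List PairBlock) (r c : ℕ), HasRepresentation A B (nonsingularPart K) P r c := by
  obtain ⟨L, P, r, c, hL, h⟩ := exists_hasRepresentation A B
  exact ⟨P, r, c, h.perm (h.nonsingularPart_perm hL hK) (List.Perm.refl P)⟩

end Uniqueness

/-! ### Contragredient equivalence -/

section Criterion

variable {F : Type*} [Field F] {m n : ℕ} {A C : Matrix (Fin m) (Fin n) F}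
  {B D : Matrix (Fin n) (Fin m) F}

lemma rank_conj_mul {S : Matrix (Fin m) (Fin m) F} {T : Matrix (Fin n) (Fin n) F} (hS : IsUnit S)
    (hT : IsUnit T) (X : Matrix (Fin m) (Fin n) F) : (S * X * T⁻¹).rank = X.rank := by
  rw [rank_mul_eq_left_of_isUnit_det, rank_mul_eq_right_of_isUnit_det]
  · exact (isUnit_iff_isUnit_det S).1 hS
  · exact isUnit_nonsing_inv_det _ ((isUnit_iff_isUnit_det T).1 hT)

lemma conj_pow {S : Matrix (Fin m) (Fin m) F} (hS : IsUnit S) (X : Matrix (Fin m) (Fin m) F)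
    (k : ℕ) : (S * X * S⁻¹) ^ k = S * X ^ k * S⁻¹ := by
  have h := nonsing_inv_mul S ((isUnit_iff_isUnit_det S).1 hS)
  have h' := mul_nonsing_inv S ((isUnit_iff_isUnit_det S).1 hS)
  induction k with
  | zero => simp [h']
  | succ k ih =>
    rw [pow_succ, ih, pow_succ]
    calc S * X ^ k * S⁻¹ * (S * X * S⁻¹) = S * X ^ k * (S⁻¹ * S) * X * S⁻¹ := by
          simp only [Matrix.mul_assoc]
      _ = _ := by rw [h, Matrix.mul_one]; simp only [Matrix.mul_assoc]

lemma ContragredientlyEquivalent.swap (h : ContragredientlyEquivalent A B C D) :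
    ContragredientlyEquivalent B A D C := by
  obtain ⟨S, T, hS, hT, hA, hB⟩ := h
  exact ⟨T, S, hT, hS, hB, hA⟩

lemma ContragredientlyEquivalent.similar (h : ContragredientlyEquivalent A B C D) :
    Similar (A * B) (C * D) := by
  obtain ⟨S, T, hS, hT, rfl, rfl⟩ := h
  refine ⟨S, hS, ?_⟩
  calc S * C * T⁻¹ * (T * D * S⁻¹) = S * C * (T⁻¹ * T) * D * S⁻¹ := by
        simp only [Matrix.mul_assoc]
    _ = _ := by
        rw [nonsing_inv_mul T ((isUnit_iff_isUnit_det T).1 hT), Matrix.mul_one]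
        simp only [Matrix.mul_assoc]

lemma ContragredientlyEquivalent.sameAlternatingRanks (h : ContragredientlyEquivalent A B C D)
    (t : ℕ) : SameAlternatingRanks A B C D t := by
  obtain ⟨S, T, hS, hT, rfl, rfl⟩ := h
  have hT' := nonsing_inv_mul T ((isUnit_iff_isUnit_det T).1 hT)
  have hS' := nonsing_inv_mul S ((isUnit_iff_isUnit_det S).1 hS)
  have hBA (k : ℕ) : (T * D * S⁻¹ * (S * C * T⁻¹)) ^ k = T * (D * C) ^ k * T⁻¹ := by
    rw [← conj_pow hT]
    congr 1
    calc T * D * S⁻¹ * (S * C * T⁻¹) = T * D * (S⁻¹ * S) * C * T⁻¹ := by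
          simp only [Matrix.mul_assoc]
      _ = _ := by rw [hS', Matrix.mul_one]; simp only [Matrix.mul_assoc]
  refine ⟨fun k _ => ?_, fun k _ _ => ?_⟩
  · rw [hBA, ← rank_conj_mul hS hT (C * (D * C) ^ k)]
    congr 1
    calc S * C * T⁻¹ * (T * (D * C) ^ k * T⁻¹) = S * C * (T⁻¹ * T) * (D * C) ^ k * T⁻¹ := by
          simp only [Matrix.mul_assoc]
      _ = _ := by rw [hT', Matrix.mul_one]; simp only [Matrix.mul_assoc]
  · rw [hBA, rank_conj_mul hT hT]

lemma represents_toLin' (A : Matrix (Fin m) (Fin n) F) (B : Matrix (Fin n) (Fin m) F) :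
    Represents (toLin' A) (toLin' B) A B :=
  ⟨Pi.basisFun F (Fin n), Pi.basisFun F (Fin m),
    by rw [← toLin_eq_toLin', LinearMap.toMatrix_toLin],
    by rw [← toLin_eq_toLin', LinearMap.toMatrix_toLin]⟩

lemma Similar.isJordanForm (h : Similar (A * B) (C * D)) {K : List (JordanBlock F)}
    (hK : IsJordanForm K (toLin' A ∘ₗ toLin' B)) : IsJordanForm K (toLin' C ∘ₗ toLin' D) := by
  obtain ⟨S, hS, h⟩ := h
  obtain ⟨b, hb⟩ := hK
  have hSS' := mul_nonsing_inv S ((isUnit_iff_isUnit_det S).1 hS)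
  have hS'S := nonsing_inv_mul S ((isUnit_iff_isUnit_det S).1 hS)
  refine ⟨b.map (toLin'OfInv hSS' hS'S), ?_⟩
  rw [toMatrix_eq_iff] at hb ⊢
  intro j
  have h1 := congrArg (toLin' S⁻¹) (hb j)
  rw [map_sum, ← toLin'_mul, h, ← LinearMap.comp_apply, ← toLin'_mul, ← Matrix.mul_assoc,
    ← Matrix.mul_assoc, hS'S, Matrix.one_mul, toLin'_mul] at h1
  rw [← toLin'_mul]
  refine Eq.trans ?_ (h1.trans (Finset.sum_congr rfl fun i _ => ?_))
  · rfl
  · rw [map_smul]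
    rfl

lemma HasRepresentation.rows_le_or_cols_le {V W : Type*} [AddCommGroup V] [Module F V]
    [FiniteDimensional F V] [AddCommGroup W] [Module F W] [FiniteDimensional F W]
    {f : V →ₗ[F] W} {g : W →ₗ[F] V} {L : List (JordanBlock F)} {P : List PairBlock} {r c : ℕ}
    (h : HasRepresentation f g L P r c) :
    ∀ b ∈ P, b.rows ≤ min (Module.finrank F W) (Module.finrank F V) ∨
      b.cols ≤ min (Module.finrank F W) (Module.finrank F V) := by
  intro b hb
  obtain ⟨i, rfl⟩ := List.mem_iff_get.1 hb
  have h' : Represents f g (canonA L P r c) (canonB L P r c) := h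
  have h1 : (P.get i).rows ≤ Module.finrank F W := by
    rw [← h'.card_rows, ← Fintype.card_fin (P.get i).rows]
    exact Fintype.card_le_of_injective (fun x => Sum.inr (Sum.inl ⟨i, x⟩))
      (fun x y hxy => by simpa using hxy)
  have h2 : (P.get i).cols ≤ Module.finrank F V := by
    rw [← h'.swap.card_rows, ← Fintype.card_fin (P.get i).cols]
    exact Fintype.card_le_of_injective (fun x => Sum.inr (Sum.inl ⟨i, x⟩))
      (fun x y hxy => by simpa using hxy)
  omega

/-- Similarity of `AB` and `CD` allows the same nonsingular part for both canonical forms; the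
ranks make the remaining blocks agree up to their order. -/
lemma contragredientlyEquivalent_of_ranks (h : Similar (A * B) (C * D))
    (h₁ : SameAlternatingRanks A B C D (min m n)) (h₂ : SameAlternatingRanks B A D C (min m n)) :
    ContragredientlyEquivalent A B C D := by
  obtain ⟨K, hK⟩ := exists_isJordanForm (toLin' A ∘ₗ toLin' B)
  obtain ⟨P, r, c, hP⟩ := exists_hasRepresentation_nonsingularPart (toLin' A) (toLin' B) hK
  obtain ⟨P', r', c', hP'⟩ :=
    exists_hasRepresentation_nonsingularPart (toLin' C) (toLin' D) (h.isJordanForm hK)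
  have hJ := isUnit_jordanMat (L := nonsingularPart K) fun b hb => by
    simpa [nonsingularPart] using (List.mem_filter.1 hb).2
  have hR : Represents (toLin' A) (toLin' B) (canonA (nonsingularPart K) P r c)
    (canonB (nonsingularPart K) P r c) := hP
  have hR' : Represents (toLin' C) (toLin' D) (canonA (nonsingularPart K) P' r' c')
    (canonB (nonsingularPart K) P' r' c') := hP'
  have hAB := represents_toLin' A B
  have hCD := represents_toLin' C D
  obtain ⟨hperm, rfl, rfl⟩ : P.Perm P' ∧ r = r' ∧ c = c' := by
    refine perm_of_bounded_word_ranks (n := Fintype.card (JordanIdx (nonsingularPart K)))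
      (t := min m n) (by simpa using hP.rows_le_or_cols_le) (by simpa using hP'.rows_le_or_cols_le)
      (fun k hk => ?_) (fun k hk => ?_) (fun k hk => ?_) (fun k hk => ?_)
    · rw [← rank_canonA_word _ P r c hJ, ← rank_canonA_word _ P' r' c' hJ, hR.rank_word,
        hR'.rank_word, ← hAB.rank_word, ← hCD.rank_word]
      exact h₁.1 k hk
    · rw [← rank_canonB_word _ P r c hJ, ← rank_canonB_word _ P' r' c' hJ, hR.swap.rank_word,
        hR'.swap.rank_word, ← hAB.swap.rank_word, ← hCD.swap.rank_word]
      exact h₂.1 k hk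
    · rw [← rank_canonAB_pow _ P r c hJ, ← rank_canonAB_pow _ P' r' c' hJ, hR.rank_pow,
        hR'.rank_pow, ← hAB.rank_pow, ← hCD.rank_pow]
      rcases Nat.eq_zero_or_pos k with rfl | hk0
      · rw [pow_zero, pow_zero]
      · exact h₂.2 k hk0 hk
    · rw [← rank_canonBA_pow _ P r c hJ, ← rank_canonBA_pow _ P' r' c' hJ, hR.swap.rank_pow,
        hR'.swap.rank_pow, ← hAB.swap.rank_pow, ← hCD.swap.rank_pow]
      rcases Nat.eq_zero_or_pos k with rfl | hk0
      · rw [pow_zero, pow_zero]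
      · exact h₁.2 k hk0 hk
  have hR'' : Represents (toLin' C) (toLin' D) (canonA (nonsingularPart K) P r c)
    (canonB (nonsingularPart K) P r c) := hP'.perm (List.Perm.refl _) hperm.symm
  obtain ⟨S, T, hST, hTS⟩ := hR.exists_equiv hR''
  let S' := LinearMap.toMatrix' S.toLinearMap
  let T' := LinearMap.toMatrix' T.toLinearMap
  have hS : S' * LinearMap.toMatrix' S.symm.toLinearMap = 1 := by
    simp [S', ← LinearMap.toMatrix'_comp]
  have hT : T' * LinearMap.toMatrix' T.symm.toLinearMap = 1 := by
    simp [T', ← LinearMap.toMatrix'_comp]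
  have hS' : IsUnit S'.det := isUnit_det_of_right_inverse hS
  have hT' : IsUnit T'.det := isUnit_det_of_right_inverse hT
  have hST' : A * T' = S' * C := by
    simpa [LinearMap.toMatrix'_comp] using congrArg LinearMap.toMatrix' hST
  have hTS' : B * S' = T' * D := by
    simpa [LinearMap.toMatrix'_comp] using congrArg LinearMap.toMatrix' hTS
  refine ⟨S', T', (isUnit_iff_isUnit_det _).2 hS', (isUnit_iff_isUnit_det _).2 hT', ?_, ?_⟩
  · rw [← hST', Matrix.mul_assoc, mul_nonsing_inv _ hT', Matrix.mul_one]
  · rw [← hTS', Matrix.mul_assoc, mul_nonsing_inv _ hS', Matrix.mul_one]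

end Criterion

end Contragredient

theorem theorem2 {F : Type*} [Field F] {V W : Type*}
    [AddCommGroup V] [Module F V] [FiniteDimensional F V]
    [AddCommGroup W] [Module F W] [FiniteDimensional F W]
    (A : V →ₗ[F] W) (B : W →ₗ[F] V) :
    -- existence: `A ∘ₗ B` has a Jordan form, and the pair has a canonical form with its
    -- nonsingular part (for whichever order of the blocks of that Jordan form)
    (∃ K : List (Contragredient.JordanBlock F), Contragredient.IsJordanForm K (A ∘ₗ B)) ∧
    (∀ K : List (Contragredient.JordanBlock F), Contragredient.IsJordanForm K (A ∘ₗ B) →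
      ∃ (P : List Contragredient.PairBlock) (r c : ℕ),
        Contragredient.HasRepresentation A B (Contragredient.nonsingularPart K) P r c) ∧
    -- uniqueness up to the order of the blocks
    (∀ (L L' : List (Contragredient.JordanBlock F)) (P P' : List Contragredient.PairBlock)
        (r r' c c' : ℕ),
      (∀ b ∈ L, b.Nonsingular) → (∀ b ∈ L', b.Nonsingular) →
      Contragredient.HasRepresentation A B L P r c →
      Contragredient.HasRepresentation A B L' P' r' c' →
      L.Perm L' ∧ P.Perm P' ∧ r = r' ∧ c = c') ∧
    -- the criterion for contragredient equivalence
    (∀ (m n : ℕ) (A₁ C₁ : Matrix (Fin m) (Fin n) F) (B₁ D₁ : Matrix (Fin n) (Fin m) F),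
      Contragredient.ContragredientlyEquivalent A₁ B₁ C₁ D₁ ↔
        Contragredient.Similar (A₁ * B₁) (C₁ * D₁) ∧
        Contragredient.SameAlternatingRanks A₁ B₁ C₁ D₁ (min m n) ∧
        Contragredient.SameAlternatingRanks B₁ A₁ D₁ C₁ (min m n)) := by
  refine ⟨Contragredient.exists_isJordanForm _,
    fun K hK => Contragredient.exists_hasRepresentation_nonsingularPart A B hK,
    fun L L' P P' r r' c c' hL hL' h h' => h.unique hL hL' h', fun m n A₁ C₁ B₁ D₁ => ⟨fun h => ?_,
    fun h => Contragredient.contragredientlyEquivalent_of_ranks h.1 h.2.1 h.2.2⟩⟩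
  exact ⟨h.similar, h.sameAlternatingRanks _, h.swap.sameAlternatingRanks _⟩
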